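/- \textbf{Setting.} Let $V$ be a $7$-dimensional vector space over $\mathbb{F}\in\{\mathbb{R},\mathbb{C}\}$. For a basis $e_1,\dots,e_7$ with dual basis $e^1,\dots,e^7$ write $e^{i_1\cdots i_k}=e^{i_1}\wedge\cdots\wedge e^{i_k}$. For $\varepsilon\in\{1,-1\}$ put $$\varphi_\varepsilon=\varepsilon(e^{127}+e^{347})+e^{567}+e^{135}-e^{146}-e^{236}-e^{245}.$$ A $G_2$-structure (respectively $G_2^*$-structure) on a real $V$ is a $\varphi\in\Lambda^3V^*$ equal to $\varphi_{1}$ (respectively $\varphi_{-1}$) in some basis, called an adapted basis; it induces the volume form $\mathrm{vol}=e^{1234567}$ (independent of the adapted basis). A $(G_2)_{\mathbb{C}}$-structure on a complex $V$ is a pair $(\varphi,\mathrm{vol})\in\Lambda^3V^*\times\Lambda^7V^*$ with $\varphi=\varphi_{1}$ and $\mathrm{vol}=e^{1234567}$ in some common basis. In each case a non-degenerate symmetric bilinear form $g$ is induced by $$g(v,w)\,\mathrm{vol}=\tfrac16\,(v\lrcorner\varphi)\wedge(w\lrcorner\varphi)\wedge\varphi ,$$ and the Hodge dual $\star_\varphi\varphi\in\Lambda^4V^*$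 is defined by $\varphi\wedge\psi=g(\star_\varphi\varphi,\psi)\,\mathrm{vol}$ for all $\psi\in\Lambda^4V^*$. On a Lie algebra $\mathfrak{g}$ let $d$ be the Chevalley--Eilenberg differential on $\Lambda^*\mathfrak{g}^*$, with $d\alpha(X,Y)=-\alpha([X,Y])$ for $\alpha\in\mathfrak{g}^*$; a structure as above on $\mathfrak{g}$ is cocalibrated if $d\star_\varphi\varphi=0$. The length $l(\Omega)$ of $\Omega\in\Lambda^kU$ is the smallest $l$ such that $\Omega$ is a sum of $l$ decomposable elements $u_1\wedge\cdots\wedge u_k$ with $u_i\in U$. \textbf{Proposition.} Let $\mathfrak{g}$ be a seven-dimensional $\mathbb{F}$-Lie algebra with a six-dimensional abelian ideal $\mathfrak{u}$, let $e_7\in\mathfrak{g}\setminus\mathfrak{u}$, and let $\mathrm{Ann}\langle e_7\rangle\subseteq\mathfrak{g}^*$ be the annihilator of $e_7$ (so that $\Lambda^4\mathrm{Ann}\langle e_7\rangle\cong\Lambda^4\mathfrak{u}^*$). \begin{enumerate} \item[(a)] If $\mathbb{F}=\mathbb{R}$, the following are equivalent: (i) $\mathfrak{g}$ admits a cocalibrated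 $G_2$-structure; (ii) there is a closed $\Omega\in\Lambda^4\mathrm{Ann}\langle e_7\rangle$ with $l(\Omega)=3$; (iii) $\mathfrak{g}$ admits a cocalibrated $G_2^*$-structure such that $\mathfrak{u}$ is non-degenerate with respect to the induced pseudo-Euclidean metric $g$. \item[(b)] If $\mathbb{F}=\mathbb{R}$, $\mathfrak{g}$ admits a cocalibrated $G_2^*$-structure if and only if there is a closed $\Omega\in\Lambda^4\mathrm{Ann}\langle e_7\rangle$ with $l(\Omega)\ge2$. \item[(c)] If $\mathbb{F}=\mathbb{C}$, $\mathfrak{g}$ admits a cocalibrated $(G_2)_{\mathbb{C}}$-structure if and only if there is a closed $\Omega\in\Lambda^4\mathrm{Ann}\langle e_7\rangle$ with $l(\Omega)\ge2$; and $\mathfrak{g}$ admits a cocalibrated $(G_2)_{\mathbb{C}}$-structure such that $\mathfrak{u}$ is non-degenerate with respect to the induced symmetric bilinear form $g$ if and only if there is a closed $\Omega\in\Lambda^4\mathrm{Ann}\langle e_7\rangle$ with $l(\Omega)=3$. \end{enumerate} -/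

import Mathlib

namespace CocalibratedG2

open Module

universe u v

/-! ### Exterior forms on a vector space -/

/-- `Λᵏ V*`, as the `k`-th exterior power of the dual space. The wedge product is the product of the
ambient exterior algebra `ExteriorAlgebra F (Dual F V)`. -/
abbrev Form (F : Type u) (V : Type v) [Field F] [AddCommGroup V] [Module F V] (k : ℕ) :=
  ⋀[F]^k (Dual F V)

/-- A `k`-form as an alternating map: `(α₁ ∧ ⋯ ∧ αₖ)(v₁, …, vₖ) = det (αᵢ (vⱼ))`. -/
noncomputable def formEval {F : Type u} {V : Type v} [Field F] [AddCommGroup V] [Module F V]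
    {k : ℕ} (φ : Form F V k) : V [⋀^Fin k]→ₗ[F] F :=
  exteriorPower.alternatingMapLinearEquiv.symm (exteriorPower.pairingDual F V k φ)

/-- The contraction `v ⌟ x` of an exterior form with a vector. -/
noncomputable def hook {F : Type u} {V : Type v} [Field F] [AddCommGroup V] [Module F V]
    (v : V) (x : ExteriorAlgebra F (Dual F V)) : ExteriorAlgebra F (Dual F V) :=
  CliffordAlgebra.contractLeft (Dual.eval F V v) x

/-- The (irreducible) length of a `k`-vector `X ∈ Λᵏ M` (used for `k ≥ 1`): the smallest `l` such
that `X` is a sum of `l` decomposable `k`-vectors `v₁ ∧ ⋯ ∧ vₖ` with `v₁, …, vₖ ∈ M`. -/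
noncomputable def kLength {F : Type u} {M : Type v} [Field F] [AddCommGroup M] [Module F M]
    {k : ℕ} (X : ⋀[F]^k M) : ℕ :=
  sInf {l : ℕ | ∃ v : Fin l → Fin k → M, X = ∑ i, exteriorPower.ιMulti F k (v i)}

/-! ### The metric on forms and the Hodge dual -/

/-- The inverse `V* → V` of `v ↦ g(v, ·)` for a non-degenerate bilinear form `g` on a
finite-dimensional space (and `0` if there is no inverse). -/
noncomputable def sharp {F : Type u} {V : Type v} [Field F] [AddCommGroup V] [Module F V]
    (g : LinearMap.BilinForm F V) : Dual F V →ₗ[F] V :=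
  open Classical in
  if h : Function.Bijective (g : V →ₗ[F] Dual F V) then
    ((LinearEquiv.ofBijective (g : V →ₗ[F] Dual F V) h).symm : Dual F V →ₗ[F] V)
  else 0

/-- The bilinear form induced by `g` on `Λᵏ V*`, i.e.
`g(α₁ ∧ ⋯ ∧ αₖ, β₁ ∧ ⋯ ∧ βₖ) = det (g(αᵢ, βⱼ))` where `g(α, β) = α (sharp g β)` on `V*`. -/
noncomputable def formInner {F : Type u} {V : Type v} [Field F] [AddCommGroup V] [Module F V]
    (g : LinearMap.BilinForm F V) {k : ℕ} (χ φ : Form F V k) : F :=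
  exteriorPower.pairingDual F V k χ (exteriorPower.map k (sharp g) φ)

/-- `χ` is the Hodge dual `⋆ψ` with respect to `g` and `vol`:
`ψ ∧ φ = g(χ, φ) vol` for all forms `φ` of the complementary degree. -/
def IsHodgeDual {F : Type u} {V : Type v} [Field F] [AddCommGroup V] [Module F V]
    (g : LinearMap.BilinForm F V) {n k l : ℕ} (vol : Form F V n)
    (ψ : Form F V k) (χ : Form F V l) : Prop :=
  ∀ φ : Form F V l,
    (ψ : ExteriorAlgebra F (Dual F V)) * (φ : ExteriorAlgebra F (Dual F V)) =
      formInner g χ φ • (vol : ExteriorAlgebra F (Dual F V))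

/-! ### The model forms

The vectors of a basis are numbered from `0` to `6` here, and from `1` to `7` in the comments. -/

/-- `e^{i₁ ⋯ iₖ} = e^{i₁} ∧ ⋯ ∧ e^{iₖ}`, where `e¹, …, e⁷` is the dual basis of `b`. -/
noncomputable def mono {F : Type u} {V : Type v} [Field F] [AddCommGroup V] [Module F V]
    (b : Basis (Fin 7) F V) {k : ℕ} (i : Fin k → Fin 7) : Form F V k :=
  exteriorPower.ιMulti F k (fun j => b.coord (i j))

/-- `e^{1234567}`. -/
noncomputable def volForm {F : Type u} {V : Type v} [Field F] [AddCommGroup V] [Module F V]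
    (b : Basis (Fin 7) F V) : Form F V 7 :=
  mono b ![0, 1, 2, 3, 4, 5, 6]

/-- `e^{127} + e^{347} + e^{567} + e^{135} - e^{146} - e^{236} - e^{245}`. -/
noncomputable def g2Form {F : Type u} {V : Type v} [Field F] [AddCommGroup V] [Module F V]
    (b : Basis (Fin 7) F V) : Form F V 3 :=
  mono b ![0, 1, 6] + mono b ![2, 3, 6] + mono b ![4, 5, 6] + mono b ![0, 2, 4]
    - mono b ![0, 3, 5] - mono b ![1, 2, 5] - mono b ![1, 3, 4]

/-- `-e^{127} - e^{347} + e^{567} + e^{135} - e^{146} - e^{236} - e^{245}`. -/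
noncomputable def g2StarForm {F : Type u} {V : Type v} [Field F] [AddCommGroup V] [Module F V]
    (b : Basis (Fin 7) F V) : Form F V 3 :=
  - mono b ![0, 1, 6] - mono b ![2, 3, 6] + mono b ![4, 5, 6] + mono b ![0, 2, 4]
    - mono b ![0, 3, 5] - mono b ![1, 2, 5] - mono b ![1, 3, 4]

/-- `g(v, w) vol = (1/6) (v ⌟ φ) ∧ (w ⌟ φ) ∧ φ` for all vectors `v`, `w`. -/
def IsInducedMetric {F : Type u} {V : Type v} [Field F] [AddCommGroup V] [Module F V]
    (φ : Form F V 3) (vol : Form F V 7) (g : LinearMap.BilinForm F V) : Prop :=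
  ∀ v w : V, g v w • (vol : ExteriorAlgebra F (Dual F V)) =
    (1 / 6 : F) • (hook v φ * hook w φ * (φ : ExteriorAlgebra F (Dual F V)))

/-- `φ` is a `G₂`-structure on the real vector space `V`, and `vol` and `g` are the volume form and
the metric that it induces: an adapted basis of `φ` is oriented and orthonormal. Over the reals all
adapted bases of `φ` define the same volume form. -/
structure IsG2Structure {V : Type v} [AddCommGroup V] [Module ℝ V]
    (φ : Form ℝ V 3) (vol : Form ℝ V 7) (g : LinearMap.BilinForm ℝ V) : Prop where
  adapted : ∃ b : Basis (Fin 7) ℝ V, φ = g2Form b ∧ vol = volForm b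
  metric : IsInducedMetric φ vol g

/-- `φ` is a `G₂*`-structure on the real vector space `V`, and `vol` and `g` are the volume form and
the pseudo-Euclidean metric of signature `(3, 4)` that it induces. Over the reals all adapted bases
of `φ` define the same volume form. -/
structure IsG2StarStructure {V : Type v} [AddCommGroup V] [Module ℝ V]
    (φ : Form ℝ V 3) (vol : Form ℝ V 7) (g : LinearMap.BilinForm ℝ V) : Prop where
  adapted : ∃ b : Basis (Fin 7) ℝ V, φ = g2StarForm b ∧ vol = volForm b
  metric : IsInducedMetric φ vol g

/-- The pair `(φ, vol)` is a `(G₂)_ℂ`-structure on the complex vector space `W`, and `g` is the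
complex symmetric bilinear form that it induces. -/
structure IsG2CStructure {W : Type v} [AddCommGroup W] [Module ℂ W]
    (φ : Form ℂ W 3) (vol : Form ℂ W 7) (g : LinearMap.BilinForm ℂ W) : Prop where
  adapted : ∃ b : Basis (Fin 7) ℂ W, φ = g2Form b ∧ vol = volForm b
  metric : IsInducedMetric φ vol g

/-! ### The exterior derivative on a Lie algebra -/

/-- The exterior derivative on forms on a Lie algebra (left-invariant forms on the group),
`dχ(x₀, …, xₘ) = ∑_{i < j} (-1)^{i+j} χ([xᵢ, xⱼ], x₀, …, x̂ᵢ, …, x̂ⱼ, …, xₘ)`,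
as a function of `m + 1 = k + 2` vectors; `dα(x, y) = -α([x, y])` for a one-form `α`. -/
noncomputable def lieD {F : Type u} {L : Type v} [Field F] [LieRing L] [LieAlgebra F L] {k : ℕ}
    (χ : Form F L (k + 1)) (x : Fin (k + 2) → L) : F :=
  ∑ j : Fin (k + 2), ∑ i : Fin (k + 1),
    if i.castSucc < j then
      (-1 : F) ^ ((i : ℕ) + (j : ℕ)) *
        formEval χ (Matrix.vecCons ⁅x i.castSucc, x j⁆ (i.removeNth (j.removeNth x)))
    else 0

/-- `dχ = 0`. -/
def IsClosedForm {F : Type u} {L : Type v} [Field F] [LieRing L] [LieAlgebra F L] {k : ℕ}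
    (χ : Form F L (k + 1)) : Prop :=
  ∀ x : Fin (k + 2) → L, lieD χ x = 0

/-- The three-form `φ` is cocalibrated with respect to `vol` and `g`: `⋆φ` is closed. -/
def IsCocalibrated {F : Type u} {L : Type v} [Field F] [LieRing L] [LieAlgebra F L]
    (φ : Form F L 3) (vol : Form F L 7) (g : LinearMap.BilinForm F L) : Prop :=
  ∃ χ : Form F L 4, IsHodgeDual g vol φ χ ∧ IsClosedForm χ

/-- An element of `Λᵏ (Ann⟨e⟩)`, where `Ann⟨e⟩ ⊆ L*` is the annihilator of `e`, as a form on `L`. -/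
noncomputable def annForm {F : Type u} {L : Type v} [Field F] [AddCommGroup L] [Module F L]
    {e : L} {k : ℕ} (Ω : ⋀[F]^k (Submodule.dualAnnihilator (Submodule.span F {e}))) : Form F L k :=
  exteriorPower.map k (Submodule.subtype (Submodule.dualAnnihilator (Submodule.span F {e}))) Ω

end CocalibratedG2

/-! Let `η` be the one-form with kernel `𝔲` and `η e = 1`. Since `𝔲` is an abelian ideal, `⁅x, y⁆ =
η x • D y - η y • D x` with `D = ad e` and `η ∘ D = 0`. Thus `dη = 0` and `dα` is a multiple of `η`
for every one-form `α`, so every four-form divisible by `η` is closed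
(`multiplesOf_le_closedForms`). Write `⋆φ = Ω + (multiple of η)` with `Ω` in the fourth exterior
power of `Ann⟨e⟩`; then `⋆φ` is closed iff `Ω` is. What remains is linear algebra: which `Ω` occur,
up to scalars, as this component of some `⋆φ_ε`.

Necessity. One has `⋆φ ∧ η = Ω ∧ η`. If `Ω` is a sum of `l` decomposables, the pairing `(x, y) ↦ x ∧
y ∧ ⋆φ ∧ η` has kernel of dimension at least `7 - 2l` (`seven_le_finrank_wedgeKernel`). This pairing
is the cross product with `η`. If `η` is non-null, which means that `𝔲` is non-degenerate, the
double cross product identity bounds the kernel by the line of `η`, so `l ≥ 3`. If only `η ≠ 0` is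
known, some Pfaffian of order four is nonzero, so the kernel has dimension at most `4` and `l ≥ 2`.
For a definite metric `η` is never null.

Sufficiency. In dimension six, `Ω` corresponds to the alternating form `(x, y) ↦ x ∧ y ∧ Ω`. If its
rank is `2r`, then `Ω` is a scalar times a standard sum of `r` decomposables
(`fourForm_normalForm`). Hence length three forces `r = 3`, and length at least two forces `r ≥ 2`.
Modulo `η`, the form with `r = 3` is `⋆φ_ε` with `η = e⁷`, for either sign
(`exists_starForm_of_three`), and the form with `r = 2` is `⋆φ₋₁` with the null covector `η = e¹ +
e⁷` (`exists_starForm_of_two`). Over `ℂ`, `φ₁` and `φ₋₁` agree after rescaling the basis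
(`exists_phiForm_one_eq`). -/

namespace CocalibratedG2

open Module

/-! ### Words in anticommuting generators -/

section Words

variable {n : ℕ} {A : Type*} [Ring A]

/-- The product of the generators `a i` along a word. -/
def wordProd (a : Fin n → A) (l : List (Fin n)) : A := (l.map a).prod

/-- A formal integral combination of words. -/
abbrev WordSum (n : ℕ) := List (ℤ × List (Fin n))

/-- The value of a formal combination of words. -/
def WordSum.eval (a : Fin n → A) (p : WordSum n) : A :=
  (p.map fun t => t.1 • wordProd a t.2).sum

/-- The product of formal combinations of words. -/
def WordSum.mul (p q : WordSum n) : WordSum n :=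
  p.flatMap fun s => q.map fun t => (s.1 * t.1, s.2 ++ t.2)

/-- Multiplication of a formal combination of words by an integer. -/
def WordSum.smul (c : ℤ) (p : WordSum n) : WordSum n := p.map fun t => (c * t.1, t.2)

/-- Insertion of a letter into a sorted word, with the resulting sign. -/
def insertLetter (i : Fin n) : List (Fin n) → ℤ × List (Fin n)
  | [] => (1, [i])
  | j :: l =>
    if i < j then (1, i :: j :: l)
    else if i = j then (0, [])
    else (-(insertLetter i l).1, j :: (insertLetter i l).2)

/-- Sorting of a word, with the resulting sign (`0` if a letter is repeated). -/
def sortWord : List (Fin n) → ℤ × List (Fin n)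
  | [] => (1, [])
  | i :: l => ((sortWord l).1 * (insertLetter i (sortWord l).2).1,
      (insertLetter i (sortWord l).2).2)

/-- Addition of a term to a formal combination of words, collecting equal words. -/
def WordSum.addTerm (c : ℤ) (l : List (Fin n)) : WordSum n → WordSum n
  | [] => [(c, l)]
  | t :: p => if t.2 = l then (t.1 + c, t.2) :: p else t :: WordSum.addTerm c l p

/-- Sorting of all words and collection of equal words. -/
def WordSum.normalize : WordSum n → WordSum n
  | [] => []
  | t :: p => WordSum.addTerm (t.1 * (sortWord t.2).1) (sortWord t.2).2 (WordSum.normalize p)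

/-- All coefficients of the normalization vanish. -/
def WordSum.isZero (p : WordSum n) : Bool := p.normalize.all fun t => t.1 == 0

/-- Two formal combinations of words agree up to normalization. -/
def WordSum.equiv (p q : WordSum n) : Bool := WordSum.isZero (p ++ q.smul (-1))

variable (a : Fin n → A)

@[simp] lemma wordProd_nil : wordProd a [] = 1 := rfl

@[simp] lemma wordProd_cons (i : Fin n) (l : List (Fin n)) :
    wordProd a (i :: l) = a i * wordProd a l := by
  simp [wordProd]

lemma wordProd_append (l l' : List (Fin n)) :
    wordProd a (l ++ l') = wordProd a l * wordProd a l' := by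
  simp [wordProd]

@[simp] lemma WordSum.eval_nil : WordSum.eval a [] = 0 := rfl

@[simp] lemma WordSum.eval_cons (t : ℤ × List (Fin n)) (p : WordSum n) :
    WordSum.eval a (t :: p) = t.1 • wordProd a t.2 + WordSum.eval a p := by
  simp [WordSum.eval]

lemma WordSum.eval_append (p q : WordSum n) :
    WordSum.eval a (p ++ q) = WordSum.eval a p + WordSum.eval a q := by
  simp [WordSum.eval]

lemma WordSum.eval_smul (c : ℤ) (p : WordSum n) :
    WordSum.eval a (p.smul c) = c • WordSum.eval a p := by
  induction p with
  | nil => simp [WordSum.smul]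
  | cons t p ih =>
    have : WordSum.smul c (t :: p) = (c * t.1, t.2) :: WordSum.smul c p := rfl
    rw [this, eval_cons, eval_cons, ih, smul_add, mul_smul]

lemma WordSum.eval_mul (p q : WordSum n) :
    WordSum.eval a (p.mul q) = WordSum.eval a p * WordSum.eval a q := by
  induction p with
  | nil => simp [WordSum.mul]
  | cons t p ih =>
    have h : WordSum.mul (t :: p) q = (q.map fun s => (t.1 * s.1, t.2 ++ s.2)) ++
        WordSum.mul p q := rfl
    have h' : WordSum.eval a (q.map fun s => (t.1 * s.1, t.2 ++ s.2)) =
        (t.1 • wordProd a t.2) * WordSum.eval a q := by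
      clear h ih
      induction q with
      | nil => simp
      | cons s q ih =>
        rw [List.map_cons, eval_cons, eval_cons, ih, mul_add, wordProd_append,
          smul_mul_smul_comm]
    rw [h, eval_append, ih, h', eval_cons, add_mul]

variable {a} (h : ∀ i j, a i * a j = -(a j * a i)) (h₀ : ∀ i, a i * a i = 0)

include h h₀

lemma mul_wordProd_eq_insertLetter (i : Fin n) (l : List (Fin n)) :
    a i * wordProd a l = (insertLetter i l).1 • wordProd a (insertLetter i l).2 := by
  induction l with
  | nil => simp [insertLetter]
  | cons j l ih =>
    unfold insertLetter
    split_ifs with h1 h2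
    · simp
    · subst h2
      simp [← mul_assoc, h₀]
    · rw [wordProd_cons, ← mul_assoc, h i j, neg_mul, mul_assoc, ih, wordProd_cons,
        mul_smul_comm, neg_smul]

lemma wordProd_eq_sortWord (l : List (Fin n)) :
    wordProd a l = (sortWord l).1 • wordProd a (sortWord l).2 := by
  induction l with
  | nil => simp [sortWord]
  | cons i l ih =>
    rw [wordProd_cons, ih, mul_smul_comm, mul_wordProd_eq_insertLetter h h₀, smul_smul]
    rfl

omit h h₀ in
lemma WordSum.eval_addTerm (c : ℤ) (l : List (Fin n)) (p : WordSum n) :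
    WordSum.eval a (p.addTerm c l) = c • wordProd a l + WordSum.eval a p := by
  induction p with
  | nil => simp [WordSum.addTerm]
  | cons t p ih =>
    unfold WordSum.addTerm
    split_ifs with h1
    · rw [eval_cons, eval_cons, ← h1, add_smul]; abel
    · rw [eval_cons, eval_cons, ih]; abel

lemma WordSum.eval_normalize (p : WordSum n) :
    WordSum.eval a p.normalize = WordSum.eval a p := by
  induction p with
  | nil => simp [WordSum.normalize]
  | cons t p ih =>
    unfold WordSum.normalize
    rw [eval_addTerm, ih, eval_cons, mul_smul, ← wordProd_eq_sortWord h h₀]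

lemma WordSum.eval_eq_zero {p : WordSum n} (hp : p.isZero = true) : WordSum.eval a p = 0 := by
  rw [← eval_normalize h h₀]
  unfold WordSum.isZero at hp
  generalize p.normalize = q at hp
  induction q with
  | nil => rfl
  | cons t q ih =>
    simp only [List.all_cons, Bool.and_eq_true, beq_iff_eq] at hp
    rw [eval_cons, ih hp.2, hp.1, zero_smul, zero_add]

/-- The test involves only integers and words, so the kernel can evaluate it; the resulting identity
holds for any anticommuting generators of square zero. The large explicit identities between forms
below are proved in this way. -/
lemma WordSum.eval_eq_of_equiv {p q : WordSum n} (hp : WordSum.equiv p q = true) :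
    WordSum.eval a p = WordSum.eval a q := by
  have := WordSum.eval_eq_zero h h₀ hp
  rw [eval_append, eval_smul, neg_one_smul, add_neg_eq_zero] at this
  exact this

end Words

/-! ### Words and contractions in the exterior algebra -/

section Exterior

variable {F : Type*} {W : Type*} [Field F] [AddCommGroup W] [Module F W] {n : ℕ}

open ExteriorAlgebra

lemma ι_anticomm (x y : W) : ι F x * ι F y = -(ι F y * ι F x) :=
  eq_neg_of_add_eq_zero_left (ι_add_mul_swap x y)

/-- Equality of forms in the exterior algebra by normalization of words. -/
lemma WordSum.eval_ι_eq (f : Fin n → W) {p q : WordSum n} (hp : WordSum.equiv p q = true) :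
    WordSum.eval (fun i => ι F (f i)) p = WordSum.eval (fun i => ι F (f i)) q :=
  WordSum.eval_eq_of_equiv (fun _ _ => ι_anticomm _ _) (fun _ => ι_sq_zero _) hp

lemma coe_ιMulti_eq_wordProd (f : Fin n → W) {k : ℕ} (i : Fin k → Fin n) :
    (exteriorPower.ιMulti F k (fun j => f (i j)) : ExteriorAlgebra F W) =
      wordProd (fun i => ι F (f i)) (List.ofFn i) := by
  rw [exteriorPower.ιMulti_apply_coe, ιMulti_apply, wordProd, List.map_ofFn]
  rfl

/-- The contraction of a word with the dual basis vector of the letter `i`. -/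
def contractWord (i : Fin n) : List (Fin n) → WordSum n
  | [] => []
  | j :: l => (if i = j then [(1, l)] else []) ++
      (contractWord i l).map fun t => (-t.1, j :: t.2)

/-- The contraction of a formal combination of words with the dual basis vector of `i`. -/
def WordSum.contract (i : Fin n) (p : WordSum n) : WordSum n :=
  p.flatMap fun t => WordSum.smul t.1 (contractWord i t.2)

/-- Contraction is an antiderivation: each letter that it passes costs a sign. -/
lemma contractLeft_wordProd (f : Fin n → W) (d : Dual F W) (i : Fin n)
    (hd : ∀ j, d (f j) = if i = j then 1 else 0) (l : List (Fin n)) :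
    CliffordAlgebra.contractLeft d (wordProd (fun i => ι F (f i)) l : ExteriorAlgebra F W) =
      WordSum.eval (fun i => ι F (f i)) (contractWord i l) := by
  induction l with
  | nil => simp [contractWord]
  | cons j l ih =>
    have key : ∀ p : WordSum n, WordSum.eval (fun i => ι F (f i))
        (p.map fun t => (-t.1, j :: t.2)) = -(ι F (f j) * WordSum.eval (fun i => ι F (f i)) p) := by
      intro p
      induction p with
      | nil => simp
      | cons t p ih' =>
        rw [List.map_cons, WordSum.eval_cons, WordSum.eval_cons, ih', mul_add, wordProd_cons,
          mul_smul_comm, neg_smul, neg_add]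
    rw [wordProd_cons, contractWord, WordSum.eval_append, key, ← ih,
      CliffordAlgebra.contractLeft_ι_mul, hd, sub_eq_add_neg]
    congr 1
    split_ifs <;> simp

lemma contractLeft_eval (f : Fin n → W) (d : Dual F W) (i : Fin n)
    (hd : ∀ j, d (f j) = if i = j then 1 else 0) (p : WordSum n) :
    CliffordAlgebra.contractLeft d (WordSum.eval (fun i => ι F (f i)) p : ExteriorAlgebra F W) =
      WordSum.eval (fun i => ι F (f i)) (p.contract i) := by
  induction p with
  | nil => simp [WordSum.contract]
  | cons t p ih =>
    have : WordSum.contract i (t :: p) =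
      WordSum.smul t.1 (contractWord i t.2) ++ WordSum.contract i p := rfl
    rw [this, WordSum.eval_append, WordSum.eval_smul, ← ih, ← contractLeft_wordProd f d i hd,
      WordSum.eval_cons, map_add, map_zsmul]

end Exterior

/-! ### The model forms, their metric and their Hodge dual -/

section Model

variable {F : Type*} {V : Type*} [Field F] [AddCommGroup V] [Module F V]

/-- The form `φ_ε`. -/
noncomputable def phiForm (ε : ℤ) (b : Basis (Fin 7) F V) : Form F V 3 :=
  ε • mono b ![0, 1, 6] + ε • mono b ![2, 3, 6] + mono b ![4, 5, 6] + mono b ![0, 2, 4]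
    - mono b ![0, 3, 5] - mono b ![1, 2, 5] - mono b ![1, 3, 4]

/-- The Hodge dual of `φ_ε`. -/
noncomputable def starForm (ε : ℤ) (b : Basis (Fin 7) F V) : Form F V 4 :=
  mono b ![0, 1, 2, 3] + ε • mono b ![2, 3, 4, 5] + ε • mono b ![0, 1, 4, 5]
    - mono b ![1, 3, 5, 6] + mono b ![1, 2, 4, 6] + mono b ![0, 3, 4, 6] + mono b ![0, 2, 5, 6]

/-- The signs of the metric induced by `φ_ε`. -/
def metricSign (ε : ℤ) (i : Fin 7) : ℤ := if i < 4 then ε else 1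

/-- The metric induced by `φ_ε`, for which the adapted basis is orthonormal. -/
noncomputable def diagMetric (ε : ℤ) (b : Basis (Fin 7) F V) : LinearMap.BilinForm F V :=
  ∑ i, metricSign ε i • (b.coord i).smulRight (b.coord i)

/-- `φ_ε` as a formal combination of words. -/
def phiWords (ε : ℤ) : WordSum 7 :=
  [(ε, [0, 1, 6]), (ε, [2, 3, 6]), (1, [4, 5, 6]), (1, [0, 2, 4]), (-1, [0, 3, 5]),
    (-1, [1, 2, 5]), (-1, [1, 3, 4])]

/-- The Hodge dual of `φ_ε` as a formal combination of words. -/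
def starWords (ε : ℤ) : WordSum 7 :=
  [(1, [0, 1, 2, 3]), (ε, [2, 3, 4, 5]), (ε, [0, 1, 4, 5]), (-1, [1, 3, 5, 6]),
    (1, [1, 2, 4, 6]), (1, [0, 3, 4, 6]), (1, [0, 2, 5, 6])]

lemma g2Form_eq_phiForm (b : Basis (Fin 7) F V) : g2Form b = phiForm 1 b := by
  simp [g2Form, phiForm]

lemma g2StarForm_eq_phiForm (b : Basis (Fin 7) F V) : g2StarForm b = phiForm (-1) b := by
  simp [g2StarForm, phiForm, sub_eq_add_neg]

lemma coe_mono (b : Basis (Fin 7) F V) {k : ℕ} (i : Fin k → Fin 7) :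
    (mono b i : ExteriorAlgebra F (Dual F V)) =
      wordProd (fun i => ExteriorAlgebra.ι F (b.coord i)) (List.ofFn i) :=
  coe_ιMulti_eq_wordProd _ _

lemma coe_phiForm (ε : ℤ) (b : Basis (Fin 7) F V) :
    (phiForm ε b : ExteriorAlgebra F (Dual F V)) =
      WordSum.eval (fun i => ExteriorAlgebra.ι F (b.coord i)) (phiWords ε) := by
  simp only [phiForm, Submodule.coe_add, Submodule.coe_sub, Submodule.coe_smul_of_tower, coe_mono,
    phiWords, WordSum.eval_cons, WordSum.eval_nil, List.ofFn_succ, List.ofFn_zero, one_smul,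
    neg_smul]
  simp
  abel

lemma coe_starForm (ε : ℤ) (b : Basis (Fin 7) F V) :
    (starForm ε b : ExteriorAlgebra F (Dual F V)) =
      WordSum.eval (fun i => ExteriorAlgebra.ι F (b.coord i)) (starWords ε) := by
  simp only [starForm, Submodule.coe_add, Submodule.coe_sub, Submodule.coe_smul_of_tower, coe_mono,
    starWords, WordSum.eval_cons, WordSum.eval_nil, List.ofFn_succ, List.ofFn_zero, one_smul,
    neg_smul]
  simp
  abel

lemma coe_volForm (b : Basis (Fin 7) F V) :
    (volForm b : ExteriorAlgebra F (Dual F V)) =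
      WordSum.eval (fun i => ExteriorAlgebra.ι F (b.coord i)) [(1, [0, 1, 2, 3, 4, 5, 6])] := by
  simp only [volForm, coe_mono, WordSum.eval_cons, WordSum.eval_nil, List.ofFn_succ,
    List.ofFn_zero, one_smul, add_zero]
  simp

/-- Pairing with `b₁ ∧ ⋯ ∧ b₇` gives the determinant of the identity matrix. Cancelling `vol` is
what makes the metric and the Hodge dual unique. -/
lemma volForm_ne_zero (b : Basis (Fin 7) F V) :
    (volForm b : ExteriorAlgebra F (Dual F V)) ≠ 0 := by
  intro h
  have h1 : volForm b = 0 := Subtype.ext h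
  have h2 := congrArg (fun x => exteriorPower.pairingDual F V 7 x
    (exteriorPower.ιMulti F 7 (fun i => b i))) h1
  simp only [volForm, mono, exteriorPower.pairingDual_ιMulti_ιMulti, map_zero,
    LinearMap.zero_apply] at h2
  have : (Matrix.of fun i j => b.coord (![0, 1, 2, 3, 4, 5, 6] j) (b i)) =
      (1 : Matrix (Fin 7) (Fin 7) F) := by
    have h3 : ∀ j : Fin 7, (![0, 1, 2, 3, 4, 5, 6] : Fin 7 → Fin 7) j = j := by decide
    ext i j
    simp [Matrix.one_apply, Finsupp.single_apply, h3]
  rw [this, Matrix.det_one] at h2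
  exact one_ne_zero h2

lemma diagMetric_apply (ε : ℤ) (b : Basis (Fin 7) F V) (v w : V) :
    diagMetric ε b v w = ∑ i, (metricSign ε i : F) * (b.coord i v * b.coord i w) := by
  simp [diagMetric, LinearMap.sum_apply]

lemma diagMetric_basis_right (ε : ℤ) (b : Basis (Fin 7) F V) (v : V) (i : Fin 7) :
    diagMetric ε b v (b i) = (metricSign ε i : F) * b.coord i v := by
  rw [diagMetric_apply, Finset.sum_eq_single i]
  · simp
  · intro j _ hj
    simp [Ne.symm hj]
  · simp

lemma metricSign_sq {ε : ℤ} (hε : ε = 1 ∨ ε = -1) (i : Fin 7) :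
    metricSign ε i * metricSign ε i = 1 := by
  unfold metricSign
  rcases hε with rfl | rfl <;> split_ifs <;> rfl

lemma metricSign_sq_cast {ε : ℤ} (hε : ε = 1 ∨ ε = -1) (i : Fin 7) :
    (metricSign ε i : F) * (metricSign ε i : F) = 1 := by
  exact_mod_cast congrArg (Int.cast (R := F)) (metricSign_sq hε i)

/-- A finite check over all pairs of basis vectors; the factor `6` cancels the `1/6` in the
definition of the induced metric. -/
lemma metric_words {ε : ℤ} (hε : ε = 1 ∨ ε = -1) (i j : Fin 7) :
    WordSum.equiv (((phiWords ε).contract i).mul (((phiWords ε).contract j).mul (phiWords ε)))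
      [(if i = j then 6 * metricSign ε i else 0, [0, 1, 2, 3, 4, 5, 6])] = true := by
  revert i j
  rcases hε with rfl | rfl <;> decide +kernel

lemma hook_basis_eval (b : Basis (Fin 7) F V) (i : Fin 7) (p : WordSum 7) :
    hook (b i) (WordSum.eval (fun i => ExteriorAlgebra.ι F (b.coord i)) p) =
      WordSum.eval (fun i => ExteriorAlgebra.ι F (b.coord i)) (p.contract i) := by
  apply contractLeft_eval
  intro j
  simp [Finsupp.single_apply]

/-- The bilinear map `(v, w) ↦ (v ⌟ φ) ∧ (w ⌟ φ) ∧ φ`. -/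
noncomputable def hookCube (φ : ExteriorAlgebra F (Dual F V)) :
    V →ₗ[F] V →ₗ[F] ExteriorAlgebra F (Dual F V) :=
  LinearMap.mk₂ F (fun v w => hook v φ * hook w φ * φ)
    (fun _ _ _ => by simp [hook, add_mul]) (fun _ _ _ => by simp [hook])
    (fun _ _ _ => by simp [hook, mul_add, add_mul]) (fun _ _ _ => by simp [hook])

lemma hookCube_apply (φ : ExteriorAlgebra F (Dual F V)) (v w : V) :
    hookCube φ v w = hook v φ * hook w φ * φ := rfl

lemma isInducedMetric_diagMetric [CharZero F] {ε : ℤ} (hε : ε = 1 ∨ ε = -1)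
    (b : Basis (Fin 7) F V) :
    IsInducedMetric (phiForm ε b) (volForm b) (diagMetric ε b) := by
  have key : (diagMetric ε b).compr₂
      (LinearMap.toSpanSingleton F (ExteriorAlgebra F (Dual F V)) (volForm b)) =
      (1 / 6 : F) • hookCube (phiForm ε b : ExteriorAlgebra F (Dual F V)) := by
    refine b.ext fun i => b.ext fun j => ?_
    have h := WordSum.eval_ι_eq (F := F) (fun i => b.coord i) (metric_words hε i j)
    rw [WordSum.eval_mul, WordSum.eval_mul, ← hook_basis_eval, ← hook_basis_eval, ← coe_phiForm,
      ← mul_assoc] at h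
    rw [LinearMap.compr₂_apply, LinearMap.smul_apply, LinearMap.smul_apply, hookCube_apply, h,
      LinearMap.toSpanSingleton_apply, diagMetric_basis_right, coe_volForm]
    simp only [WordSum.eval_cons, WordSum.eval_nil, add_zero, ← Int.cast_smul_eq_zsmul F,
      smul_smul]
    congr 1
    by_cases hij : i = j
    · simp [hij]
    · simp [hij]
  intro v w
  exact LinearMap.congr_fun (LinearMap.congr_fun key v) w

lemma IsInducedMetric.unique {φ : Form F V 3} {vol : Form F V 7} {g g' : LinearMap.BilinForm F V}
    (hvol : (vol : ExteriorAlgebra F (Dual F V)) ≠ 0)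
    (h : IsInducedMetric φ vol g) (h' : IsInducedMetric φ vol g') : g = g' := by
  ext v w
  have := (h v w).trans (h' v w).symm
  exact smul_left_injective F hvol this

lemma sharp_apply_apply {g : LinearMap.BilinForm F V}
    (h : Function.Bijective (g : V →ₗ[F] Dual F V)) (v : V) : sharp g (g v) = v := by
  unfold sharp
  rw [dif_pos h]
  exact (LinearEquiv.ofBijective (g : V →ₗ[F] Dual F V) h).symm_apply_apply v

lemma diagMetric_basis (ε : ℤ) (b : Basis (Fin 7) F V) (i : Fin 7) :
    diagMetric ε b (b i) = (metricSign ε i : F) • b.coord i := by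
  refine b.ext fun j => ?_
  rw [diagMetric_basis_right]
  by_cases hij : i = j
  · simp [hij]
  · simp [hij, Ne.symm hij]

lemma diagMetric_bijective {ε : ℤ} (hε : ε = 1 ∨ ε = -1) (b : Basis (Fin 7) F V) :
    Function.Bijective (diagMetric ε b : V →ₗ[F] Dual F V) := by
  have := Module.Finite.of_basis b
  have hinj : Function.Injective (diagMetric ε b : V →ₗ[F] Dual F V) := by
    rw [← LinearMap.ker_eq_bot, LinearMap.ker_eq_bot']
    intro v hv
    refine b.ext_elem fun i => ?_
    have h := LinearMap.congr_fun hv (b i)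
    rw [diagMetric_basis_right, LinearMap.zero_apply] at h
    have h2 := congrArg ((metricSign ε i : F) * ·) h
    simpa [← mul_assoc, metricSign_sq_cast hε] using h2
  exact ⟨hinj, (LinearMap.injective_iff_surjective_of_finrank_eq_finrank
    (Subspace.dual_finrank_eq).symm).1 hinj⟩

lemma sharp_diagMetric_coord {ε : ℤ} (hε : ε = 1 ∨ ε = -1) (b : Basis (Fin 7) F V) (i : Fin 7) :
    sharp (diagMetric ε b) (b.coord i) = (metricSign ε i : F) • b i := by
  have h := sharp_apply_apply (diagMetric_bijective hε b) ((metricSign ε i : F) • b i)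
  rwa [map_smul, diagMetric_basis, smul_smul, metricSign_sq_cast hε, one_smul] at h

lemma map_sharp_mono {ε : ℤ} (hε : ε = 1 ∨ ε = -1) (b : Basis (Fin 7) F V) {k : ℕ}
    (i : Fin k → Fin 7) :
    exteriorPower.map k (sharp (diagMetric ε b)) (mono b i) =
      (∏ j, (metricSign ε (i j) : F)) • exteriorPower.ιMulti F k (fun j => b (i j)) := by
  rw [mono, exteriorPower.map_apply_ιMulti, ← AlternatingMap.map_smul_univ]
  congr 1
  funext j
  exact sharp_diagMetric_coord hε b (i j)

lemma pairingDual_mono (b : Basis (Fin 7) F V) {k : ℕ} {i j : Fin k → Fin 7}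
    (hi : StrictMono i) (hj : StrictMono j) :
    exteriorPower.pairingDual F V k (mono b i) (exteriorPower.ιMulti F k (fun l => b (j l))) =
      if i = j then 1 else 0 := by
  have h₁ : ∀ i, b.coord i (b i) = 1 := by simp
  have h₀ : ∀ ⦃i j⦄, i ≠ j → b.coord i (b j) = 0 := by
    intro i j hij
    simp [Ne.symm hij]
  split_ifs with h
  · subst h
    exact exteriorPower.pairingDual_apply_apply_eq_one _ _ h₁ h₀ k
      (OrderEmbedding.ofStrictMono i hi)
  · refine exteriorPower.pairingDual_apply_apply_eq_one_zero _ _ h₀ k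
      (OrderEmbedding.ofStrictMono i hi) (OrderEmbedding.ofStrictMono j hj) fun h' => h ?_
    funext l
    exact DFunLike.congr_fun h' l

/-- Two linear maps on `Λᵏ V*` agree if they agree on all `e^{i₁ ⋯ iₖ}` with `i₁ < ⋯ < iₖ`. -/
lemma form_ext {N : Type*} [AddCommGroup N] [Module F N] (b : Basis (Fin 7) F V) {k : ℕ}
    {f g : Form F V k →ₗ[F] N}
    (h : ∀ i : Fin k → Fin 7, StrictMono i → f (mono b i) = g (mono b i)) : f = g := by
  refine (b.dualBasis.exteriorPower k).ext fun s => ?_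
  have := h _ (Set.powersetCard.ofFinEmbEquiv.symm s).strictMono
  rw [exteriorPower.basis_apply, exteriorPower.ιMulti_family, Basis.coe_dualBasis]
  exact this

/-- Pairing with `b_I` reads off the coordinate at `e^I`. -/
lemma eq_zero_of_pairingDual (b : Basis (Fin 7) F V) {k : ℕ} {χ : Form F V k}
    (h : ∀ i : Fin k → Fin 7, StrictMono i →
      exteriorPower.pairingDual F V k χ (exteriorPower.ιMulti F k (fun l => b (i l))) = 0) :
    χ = 0 := by
  refine (b.dualBasis.exteriorPower k).ext_elem fun s => ?_
  set i := Set.powersetCard.ofFinEmbEquiv.symm s with hi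
  have key : (b.dualBasis.exteriorPower k).coord s = (exteriorPower.pairingDual F V k).flip
      (exteriorPower.ιMulti F k (fun l => b (i l))) := by
    refine (b.dualBasis.exteriorPower k).ext fun t => ?_
    have ht : (b.dualBasis.exteriorPower k) t =
        mono b (Set.powersetCard.ofFinEmbEquiv.symm t) := by
      rw [exteriorPower.basis_apply, exteriorPower.ιMulti_family, Basis.coe_dualBasis]
      rfl
    rw [Basis.coord_apply, Basis.repr_self, ht, LinearMap.flip_apply,
      pairingDual_mono b (OrderEmbedding.strictMono _) (OrderEmbedding.strictMono _),
      Finsupp.single_apply]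
    have : (t = s) ↔ ((Set.powersetCard.ofFinEmbEquiv.symm t : Fin k → Fin 7) = i) := by
      rw [hi, DFunLike.coe_fn_eq, EmbeddingLike.apply_eq_iff_eq]
    simp only [this]
  rw [← Basis.coord_apply, key, map_zero, Finsupp.zero_apply, LinearMap.flip_apply,
    h _ (OrderEmbedding.strictMono _)]

/-- On `e^I` the map induced by `sharp` is `b_I` up to a product of signs, so the values `g(χ, e^I)`
determine all coordinates of `χ`. -/
lemma IsHodgeDual.unique {ε : ℤ} (hε : ε = 1 ∨ ε = -1) (b : Basis (Fin 7) F V) {k l : ℕ}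
    {ψ : Form F V k} {χ χ' : Form F V l}
    (h : IsHodgeDual (diagMetric ε b) (volForm b) ψ χ)
    (h' : IsHodgeDual (diagMetric ε b) (volForm b) ψ χ') : χ = χ' := by
  rw [← sub_eq_zero]
  refine eq_zero_of_pairingDual b fun i _ => ?_
  have h1 := smul_left_injective F (volForm_ne_zero b)
    ((h (mono b i)).symm.trans (h' (mono b i)))
  simp only [formInner, map_sharp_mono hε, map_smul, smul_eq_mul] at h1
  have hne : (∏ j, (metricSign ε (i j) : F)) ≠ 0 := Finset.prod_ne_zero_iff.2 fun j _ h0 => by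
    have := metricSign_sq_cast (F := F) hε (i j)
    simp [h0] at this
  rw [map_sub, LinearMap.sub_apply, sub_eq_zero]
  exact mul_left_cancel₀ hne h1

/-- The coefficient of `⋆φ_ε` at `e^{ijkl}`, multiplied by the sign of the metric there. -/
def starCoeff (ε : ℤ) (l : List (Fin 7)) : ℤ :=
  ((starWords ε).map fun t => t.1 * if t.2 = l then 1 else 0).sum * (l.map (metricSign ε)).prod

lemma star_words {ε : ℤ} (hε : ε = 1 ∨ ε = -1) : ∀ i j k l : Fin 7, i < j → j < k → k < l →
    WordSum.equiv ((phiWords ε).mul [(1, [i, j, k, l])])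
      [(starCoeff ε [i, j, k, l], [0, 1, 2, 3, 4, 5, 6])] = true := by
  rcases hε with rfl | rfl <;> decide +kernel

lemma formInner_starForm {ε : ℤ} (hε : ε = 1 ∨ ε = -1) (b : Basis (Fin 7) F V)
    {i : Fin 4 → Fin 7} (hi : StrictMono i) :
    formInner (diagMetric ε b) (starForm ε b) (mono b i) = (starCoeff ε (List.ofFn i) : F) := by
  have hs : ∀ j : Fin 4 → Fin 7, (∀ l : Fin 3, j l.castSucc < j l.succ) →
    exteriorPower.pairingDual F V 4 (mono b j) (exteriorPower.ιMulti F 4 (fun l => b (i l))) =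
      if List.ofFn j = List.ofFn i then 1 else 0 := by
    intro j hj
    rw [pairingDual_mono b (Fin.strictMono_iff_lt_succ.2 hj) hi]
    simp only [List.ofFn_inj]
  rw [formInner, map_sharp_mono hε, map_smul, starForm]
  simp only [map_add, map_sub, map_zsmul, LinearMap.add_apply, LinearMap.sub_apply,
    LinearMap.smul_apply]
  rw [hs _ (by decide), hs _ (by decide), hs _ (by decide), hs _ (by decide), hs _ (by decide),
    hs _ (by decide), hs _ (by decide)]
  have e : ∀ a b c d : Fin 7, List.ofFn ![a, b, c, d] = [a, b, c, d] := by
    intros; simp [List.ofFn_succ]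
  simp only [e, starCoeff, starWords, List.map_cons, List.map_nil, List.sum_cons, List.sum_nil]
  push_cast
  rw [smul_eq_mul, mul_comm]
  congr 1
  · simp only [zsmul_eq_mul]
    ring

/-- Both sides are linear in the test form, so it suffices to take increasing monomials, for which
`star_words` gives the product with `φ_ε`. -/
lemma isHodgeDual_starForm {ε : ℤ} (hε : ε = 1 ∨ ε = -1) (b : Basis (Fin 7) F V) :
    IsHodgeDual (diagMetric ε b) (volForm b) (phiForm ε b) (starForm ε b) := by
  have key : (LinearMap.mulLeft F (phiForm ε b : ExteriorAlgebra F (Dual F V))) ∘ₗ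
      (Submodule.subtype _ : Form F V 4 →ₗ[F] _) =
      (LinearMap.toSpanSingleton F (ExteriorAlgebra F (Dual F V)) (volForm b)) ∘ₗ
      (exteriorPower.pairingDual F V 4 (starForm ε b)) ∘ₗ
        exteriorPower.map 4 (sharp (diagMetric ε b)) := by
    refine form_ext b fun i hi => ?_
    have h := WordSum.eval_ι_eq (F := F) (fun i => b.coord i)
      (star_words hε (i 0) (i 1) (i 2) (i 3) (hi (by decide)) (hi (by decide)) (hi (by decide)))
    have hl : List.ofFn i = [i 0, i 1, i 2, i 3] := by simp [List.ofFn_succ]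
    have h2 := formInner_starForm (F := F) hε b hi
    rw [formInner] at h2
    rw [WordSum.eval_mul, ← coe_phiForm] at h
    simp only [LinearMap.comp_apply, LinearMap.mulLeft_apply, Submodule.subtype_apply,
      LinearMap.toSpanSingleton_apply, h2, coe_mono, coe_volForm, hl]
    simpa [← Int.cast_smul_eq_zsmul F] using h
  intro χ
  exact LinearMap.congr_fun key χ

end Model

/-! ### Closed forms and forms divisible by `η` -/

section Closed

variable {F : Type*} {L : Type*} [Field F] [LieRing L] [LieAlgebra F L]

lemma formEval_ιMulti {k : ℕ} (v : Fin k → Dual F L) (x : Fin k → L) :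
    formEval (exteriorPower.ιMulti F k v) x = Matrix.det (Matrix.of fun i j => v j (x i)) := by
  rw [formEval, exteriorPower.alternatingMapLinearEquiv_symm_apply,
    LinearMap.compAlternatingMap_apply, exteriorPower.pairingDual_ιMulti_ιMulti]

/-- The exterior derivative as a linear map in the form. -/
noncomputable def lieDLinear {k : ℕ} (x : Fin (k + 2) → L) : Form F L (k + 1) →ₗ[F] F where
  toFun χ := lieD χ x
  map_add' χ χ' := by
    simp only [lieD, formEval, map_add, AlternatingMap.add_apply, mul_add, ← Finset.sum_add_distrib]
    refine Finset.sum_congr rfl fun j _ => Finset.sum_congr rfl fun i _ => ?_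
    split_ifs <;> simp
  map_smul' c χ := by
    simp only [lieD, formEval, map_smul, AlternatingMap.smul_apply, smul_eq_mul, Finset.mul_sum,
      RingHom.id_apply]
    refine Finset.sum_congr rfl fun j _ => Finset.sum_congr rfl fun i _ => ?_
    split_ifs
    · ring
    · simp

/-- The closed forms, as a subspace. -/
noncomputable def closedForms (F L : Type*) [Field F] [LieRing L] [LieAlgebra F L] (k : ℕ) :
    Submodule F (Form F L (k + 1)) :=
  ⨅ x : Fin (k + 2) → L, LinearMap.ker (lieDLinear x)

lemma mem_closedForms {k : ℕ} {χ : Form F L (k + 1)} :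
    χ ∈ closedForms F L k ↔ IsClosedForm χ := by
  simp only [closedForms, Submodule.mem_iInf, LinearMap.mem_ker]
  rfl

/-- Expansion along the first row. That row will hold the values of the four one-forms on a bracket,
and the form `η` in slot `0` kills brackets. -/
lemma det_four_of_zero {R : Type*} [CommRing R] (p q r s : Fin 4 → R) (h : p 0 = 0) :
    Matrix.det (Matrix.of ![p, q, r, s]) =
      p 1 * (-q 0 * (r 2 * s 3 - r 3 * s 2) + r 0 * (q 2 * s 3 - q 3 * s 2)
        - s 0 * (q 2 * r 3 - q 3 * r 2))
      - p 2 * (-q 0 * (r 1 * s 3 - r 3 * s 1) + r 0 * (q 1 * s 3 - q 3 * s 1)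
        - s 0 * (q 1 * r 3 - q 3 * r 1))
      + p 3 * (-q 0 * (r 1 * s 2 - r 2 * s 1) + r 0 * (q 1 * s 2 - q 2 * s 1)
        - s 0 * (q 1 * r 2 - q 2 * r 1)) := by
  simp [Matrix.det_succ_row_zero, Fin.sum_univ_succ, Fin.succAbove, h]
  ring

/-- Conceptually, `dη = 0` and `dα = -η ∧ (α ∘ D)`, so each term of `d(η ∧ α ∧ β ∧ γ)` contains `η`
twice. The proof expands all the determinants and lets the terms cancel. -/
lemma lieD_ιMulti_of_zero {η : Dual F L} {D : L →ₗ[F] L}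
    (hη : ∀ x, η (D x) = 0) (hD : ∀ x y, ⁅x, y⁆ = η x • D y - η y • D x)
    (v : Fin 4 → Dual F L) (hv : v 0 = η) (x : Fin 5 → L) :
    lieD (exteriorPower.ιMulti F 4 v : Form F L (3 + 1)) x = 0 := by
  have key : ∀ (y z : L) (w : Fin 3 → L),
      formEval (exteriorPower.ιMulti F 4 v : Form F L (3 + 1)) (Matrix.vecCons ⁅y, z⁆ w) =
      Matrix.det (Matrix.of ![fun j => v j ⁅y, z⁆, fun j => v j (w 0), fun j => v j (w 1),
        fun j => v j (w 2)]) := by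
    intro y z w
    rw [formEval_ιMulti]
    congr 1
    ext i j
    fin_cases i <;> rfl
  have h0 : ∀ y z : L, v 0 ⁅y, z⁆ = 0 := by
    intro y z
    rw [hv, hD]
    simp [hη]
  have h1 : ∀ (j : Fin 4) (y z : L), v j ⁅y, z⁆ = v 0 y * v j (D z) - v 0 z * v j (D y) := by
    intro j y z
    rw [hD, hv]
    simp
  have key' := fun (y z : L) (w : Fin 3 → L) => (key y z w).trans
    (det_four_of_zero (fun j => v j ⁅y, z⁆) _ _ _ (h0 y z))
  unfold lieD
  simp only [key', h1]
  simp [Fin.sum_univ_succ, Fin.removeNth, Fin.succAbove]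
  ring

/-- The forms that are divisible by the one-form `η`. -/
noncomputable def multiplesOf {F V : Type*} [Field F] [AddCommGroup V] [Module F V]
    (η : Dual F V) (k : ℕ) : Submodule F (Form F V k) :=
  Submodule.span F {χ | ∃ v : Fin k → Dual F V, (∃ i, v i = η) ∧ χ = exteriorPower.ιMulti F k v}

lemma ιMulti_mem_multiplesOf {F V : Type*} [Field F] [AddCommGroup V] [Module F V]
    {η : Dual F V} {k : ℕ} {v : Fin k → Dual F V} {i : Fin k} (h : v i = η) :
    (exteriorPower.ιMulti F k v : Form F V k) ∈ multiplesOf η k :=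
  Submodule.subset_span ⟨v, ⟨i, h⟩, rfl⟩

/-- By linearity only decomposable forms matter, and a transposition brings the factor `η` to the
front. -/
lemma multiplesOf_le_closedForms {η : Dual F L} {D : L →ₗ[F] L}
    (hη : ∀ x, η (D x) = 0) (hD : ∀ x y, ⁅x, y⁆ = η x • D y - η y • D x) :
    multiplesOf η 4 ≤ closedForms F L 3 := by
  refine Submodule.span_le.2 ?_
  rintro _ ⟨v, ⟨i, hi⟩, rfl⟩
  rw [SetLike.mem_coe, mem_closedForms]
  intro x
  by_cases h0 : i = 0
  · exact lieD_ιMulti_of_zero hη hD v (h0 ▸ hi) x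
  · have h := AlternatingMap.map_swap (exteriorPower.ιMulti F 4) v (Ne.symm h0)
    rw [← neg_eq_iff_eq_neg.2 h]
    have h2 := lieD_ιMulti_of_zero hη hD (v ∘ Equiv.swap 0 i) (by simpa using hi) x
    have h3 : lieDLinear x (-(exteriorPower.ιMulti F 4 (v ∘ Equiv.swap 0 i) : Form F L (3 + 1)))
      = 0 := by
      rw [map_neg, neg_eq_zero]
      exact h2
    exact h3

/-- Since `r` changes each one-form by a multiple of `η` only, multilinear expansion of a product
leaves the product of the images plus terms having a factor `η`. -/
lemma map_sub_mem_multiplesOf {F V : Type*} [Field F] [AddCommGroup V] [Module F V]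
    {η : Dual F V} (r : Dual F V →ₗ[F] Dual F V) (hr : ∀ α, ∃ c : F, α = r α + c • η) {k : ℕ}
    (χ : Form F V k) : χ - exteriorPower.map k r χ ∈ multiplesOf η k := by
  have key : (multiplesOf η k).mkQ = (multiplesOf η k).mkQ ∘ₗ exteriorPower.map k r := by
    refine exteriorPower.linearMap_ext ?_
    ext v
    simp only [LinearMap.compAlternatingMap_apply, LinearMap.comp_apply,
      exteriorPower.map_apply_ιMulti]
    choose c hc using hr
    have hv : v = (r ∘ v) + fun i => c (v i) • η := by
      funext i
      exact hc (v i)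
    set f : MultilinearMap F (fun _ : Fin k => Dual F V) (Form F V k ⧸ multiplesOf η k) :=
      ((multiplesOf η k).mkQ.compAlternatingMap (exteriorPower.ιMulti F k)).toMultilinearMap with hf
    have h1 : f v = f (r ∘ v) := by
      conv_lhs => rw [hv]
      -- The summands are indexed by the set of slots that carry `r ∘ v`; any set other than `univ`
      -- leaves a slot with a multiple of `η`.
      rw [MultilinearMap.map_add_univ, Finset.sum_eq_single Finset.univ]
      · simp
      · intro s _ hs
        obtain ⟨i, hi⟩ : ∃ i, i ∉ s := by
          by_contra! h
          exact hs (Finset.eq_univ_iff_forall.2 h)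
        have h2 := f.map_update_smul (s.piecewise (r ∘ v) fun i => c (v i) • η) i (c (v i)) η
        rw [show Function.update (s.piecewise (r ∘ v) fun i => c (v i) • η) i (c (v i) • η) =
          s.piecewise (r ∘ v) fun i => c (v i) • η by
            rw [Function.update_eq_self_iff]; simp [hi]] at h2
        rw [h2]
        have h3 : f (Function.update (s.piecewise (r ∘ v) fun i => c (v i) • η) i η) = 0 :=
          (Submodule.Quotient.mk_eq_zero _).2 (ιMulti_mem_multiplesOf (i := i) (by simp))
        rw [h3, smul_zero]
      · simp
    exact h1
  have := LinearMap.congr_fun key χ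
  rwa [← Submodule.Quotient.mk_eq_zero, Submodule.Quotient.mk_sub, sub_eq_zero]

/-- The projection `α ↦ α - α(e) η` onto the annihilator of `e`, where `η(e) = 1`. -/
noncomputable def annProj {F V : Type*} [Field F] [AddCommGroup V] [Module F V] {e : V}
    {η : Dual F V} (h : η e = 1) :
    Dual F V →ₗ[F] Submodule.dualAnnihilator (Submodule.span F {e}) :=
  LinearMap.codRestrict _ (LinearMap.id - (Dual.eval F V e).smulRight η) fun α => by
    rw [Submodule.mem_dualAnnihilator]
    intro w hw
    obtain ⟨c, rfl⟩ := Submodule.mem_span_singleton.1 hw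
    simp [h]

lemma coe_annProj {F V : Type*} [Field F] [AddCommGroup V] [Module F V] {e : V}
    {η : Dual F V} (h : η e = 1) (α : Dual F V) : (annProj h α : Dual F V) = α - α e • η := rfl

/-- The component of a form in the exterior power of the annihilator of `e`. -/
noncomputable def annPart {F V : Type*} [Field F] [AddCommGroup V] [Module F V] {e : V}
    {η : Dual F V} (h : η e = 1) {k : ℕ} (χ : Form F V k) :
    ⋀[F]^k (Submodule.dualAnnihilator (Submodule.span F {e})) :=
  exteriorPower.map k (annProj h) χ

section AnnForm

variable {F V : Type*} [Field F] [AddCommGroup V] [Module F V] {e : V} {k : ℕ}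

lemma annForm_ιMulti (v : Fin k → Submodule.dualAnnihilator (Submodule.span F {e})) :
    annForm (exteriorPower.ιMulti F k v) = exteriorPower.ιMulti F k fun i => (v i : Dual F V) :=
  exteriorPower.map_apply_ιMulti _ _

lemma annForm_sum {l : ℕ}
    (X : Fin l → ⋀[F]^k (Submodule.dualAnnihilator (Submodule.span F {e}))) :
    annForm (∑ i, X i) = ∑ i, annForm (X i) :=
  map_sum (exteriorPower.map k (Submodule.subtype _)) _ _

lemma annForm_add (X Y : ⋀[F]^k (Submodule.dualAnnihilator (Submodule.span F {e}))) :
    annForm (X + Y) = annForm X + annForm Y :=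
  map_add (exteriorPower.map k (Submodule.subtype _)) _ _

lemma annForm_smul (c : F) (X : ⋀[F]^k (Submodule.dualAnnihilator (Submodule.span F {e}))) :
    annForm (c • X) = c • annForm X :=
  map_smul (exteriorPower.map k (Submodule.subtype _)) _ _

end AnnForm

/-- The composite of `annProj` with the inclusion is `α ↦ α - α e • η`, to which the previous
estimate modulo `η` applies. -/
lemma sub_annForm_mem_multiplesOf {F V : Type*} [Field F] [AddCommGroup V] [Module F V] {e : V}
    {η : Dual F V} (h : η e = 1) {k : ℕ} (χ : Form F V k) :
    χ - annForm (annPart h χ) ∈ multiplesOf η k := by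
  have := map_sub_mem_multiplesOf (η := η) ((Submodule.subtype _) ∘ₗ annProj h)
    (fun α => ⟨α e, by simp [coe_annProj]⟩) χ
  have h' := LinearMap.congr_fun (exteriorPower.map_comp (R := F) (M := Dual F V)
    (N := Submodule.dualAnnihilator (Submodule.span F {e})) (N' := Dual F V) (n := k) (annProj h)
    (Submodule.subtype (Submodule.dualAnnihilator (Submodule.span F {e})))) χ
  rwa [h'] at this

end Closed

/-! ### Normal form of alternating bilinear forms -/

section Alternating

variable {F : Type*} [Field F]

/-- The coefficients of the standard alternating form of rank `2 r`. -/
def stdAlt (r i j : ℕ) : ℤ :=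
  if i % 2 = 0 ∧ j = i + 1 ∧ j < 2 * r then 1
  else if j % 2 = 0 ∧ i = j + 1 ∧ i < 2 * r then -1 else 0

lemma stdAlt_succ (r i j : ℕ) : stdAlt (r + 1) (i + 2) (j + 2) = stdAlt r i j := by
  unfold stdAlt
  congr 1
  · simp only [eq_iff_iff]; omega
  · congr 1
    simp only [eq_iff_iff]; omega

/-- Normal form of alternating bilinear forms. -/
lemma exists_basis_eq_stdAlt (n : ℕ) : ∀ {W : Type*} [AddCommGroup W] [Module F W]
    [FiniteDimensional F W] (_ : finrank F W = n) (B : W →ₗ[F] W →ₗ[F] F) (_ : ∀ x, B x x = 0),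
    ∃ r, 2 * r ≤ n ∧ ∃ f : Basis (Fin n) F W, ∀ i j, B (f i) (f j) = (stdAlt r i j : F) := by
  induction n using Nat.strong_induction_on with
  | _ n ih =>
  intro W _ _ _ hW B hB
  have hneg : ∀ x y, B x y = -B y x := by
    intro x y
    have := hB (x + y)
    simp only [map_add, LinearMap.add_apply, hB, zero_add, add_zero] at this
    rw [eq_neg_iff_add_eq_zero, add_comm, this]
  by_cases h0 : B = 0
  · refine ⟨0, by omega, finBasisOfFinrankEq F W hW, fun i j => ?_⟩
    simp [h0, stdAlt]
  obtain ⟨x, y, hxy⟩ : ∃ x y, B x y = 1 := by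
    by_contra! h
    apply h0
    ext x y
    by_contra hne
    refine h x ((B x y)⁻¹ • y) ?_
    rw [map_smul, smul_eq_mul, inv_mul_cancel₀ hne]
  have hyx : B y x = -1 := by rw [hneg, hxy]
  -- The kernel of `T` is the orthogonal complement of the hyperbolic plane spanned by `x` and `y`.
  -- Surjectivity of `T` gives it codimension two, and the induction continues there.
  set T : W →ₗ[F] F × F := (B x).prod (B y) with hT
  have hsurj : Function.Surjective T := by
    rintro ⟨a, b⟩
    exact ⟨a • y - b • x, by simp [hT, hB, hxy, hyx]⟩
  have hdim := LinearMap.finrank_range_add_finrank_ker T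
  rw [LinearMap.range_eq_top.2 hsurj, finrank_top, hW] at hdim
  simp only [finrank_prod, finrank_self] at hdim
  obtain ⟨m, rfl⟩ : ∃ m, n = m + 2 := ⟨n - 2, by omega⟩
  set W' := LinearMap.ker T with hW'
  have hxW : ∀ z ∈ W', B x z = 0 := fun z hz => congrArg Prod.fst (LinearMap.mem_ker.1 hz)
  have hyW : ∀ z ∈ W', B y z = 0 := fun z hz => congrArg Prod.snd (LinearMap.mem_ker.1 hz)
  obtain ⟨r, hr, f, hf⟩ := ih m (by omega) (W := W') (by omega)
    ((B.comp W'.subtype).compl₂ W'.subtype) (fun z => hB z)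
  set v : Fin (m + 2) → W := Fin.cons x (Fin.cons y fun i => (f i : W)) with hv
  have hspan : ⊤ ≤ Submodule.span F (Set.range v) := by
    intro w _
    have hx : x ∈ Submodule.span F (Set.range v) := Submodule.subset_span ⟨0, rfl⟩
    have hy : y ∈ Submodule.span F (Set.range v) := Submodule.subset_span ⟨1, rfl⟩
    have hW'le : W' ≤ Submodule.span F (Set.range v) := by
      have := f.span_eq
      rw [← Submodule.map_subtype_top W', ← this, Submodule.map_span, Submodule.span_le]
      rintro _ ⟨_, ⟨i, rfl⟩, rfl⟩
      exact Submodule.subset_span ⟨i.succ.succ, rfl⟩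
    -- The subtracted vector is the component of `w` in the hyperbolic plane.
    have hw : w - (B x w • y - B y w • x) ∈ W' := by
      rw [hW', LinearMap.mem_ker]
      simp [hT, hB, hxy, hyx]
    have := add_mem (hW'le hw) (sub_mem (Submodule.smul_mem _ (B x w) hy)
      (Submodule.smul_mem _ (B y w) hx))
    rwa [sub_add_cancel] at this
  refine ⟨r + 1, by omega, basisOfTopLeSpanOfCardEqFinrank v hspan (by simp [hW]), ?_⟩
  rw [coe_basisOfTopLeSpanOfCardEqFinrank]
  have hW1 : ∀ i, B (f i) x = 0 := fun i => by rw [hneg, hxW _ (f i).2, neg_zero]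
  have hW2 : ∀ i, B (f i) y = 0 := fun i => by rw [hneg, hyW _ (f i).2, neg_zero]
  have h00 : B x x = ((stdAlt (r + 1) 0 0 : ℤ) : F) := by simp [hB, stdAlt]
  have h01 : B x y = ((stdAlt (r + 1) 0 1 : ℤ) : F) := by
    rw [hxy, stdAlt, if_pos (by omega)]; simp
  have h10 : B y x = ((stdAlt (r + 1) 1 0 : ℤ) : F) := by
    rw [hyx, stdAlt, if_neg (by omega), if_pos (by omega)]; simp
  have h11 : B y y = ((stdAlt (r + 1) 1 1 : ℤ) : F) := by simp [hB, stdAlt]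
  have z1 : ∀ i : ℕ, stdAlt (r + 1) 0 (i + 2) = 0 := fun i => by
    rw [stdAlt, if_neg (by omega), if_neg (by omega)]
  have z2 : ∀ i : ℕ, stdAlt (r + 1) 1 (i + 2) = 0 := fun i => by
    rw [stdAlt, if_neg (by omega), if_neg (by omega)]
  have z3 : ∀ i : ℕ, stdAlt (r + 1) (i + 2) 0 = 0 := fun i => by
    rw [stdAlt, if_neg (by omega), if_neg (by omega)]
  have z4 : ∀ i : ℕ, stdAlt (r + 1) (i + 2) 1 = 0 := fun i => by
    rw [stdAlt, if_neg (by omega), if_neg (by omega)]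
  intro i j
  refine Fin.cases ?_ (fun i => Fin.cases ?_ (fun i => ?_) i) i <;>
    refine Fin.cases ?_ (fun j => Fin.cases ?_ (fun j => ?_) j) j
  · exact h00
  · exact h01
  · exact (hxW _ (f j).2).trans (by simp [z1])
  · exact h10
  · exact h11
  · exact (hyW _ (f j).2).trans (by simp [z2])
  · exact (hW1 i).trans (by simp [z3])
  · exact (hW2 i).trans (by simp [z4])
  · refine (hf i j).trans ?_
    rw [← stdAlt_succ]
    simp

end Alternating

/-! ### Four-vectors in dimension six -/

section FourForms

variable {F : Type*} {W : Type*} [Field F] [AddCommGroup W] [Module F W]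

open ExteriorAlgebra

/-- The coefficient of the top degree part of an element of the exterior algebra. -/
noncomputable def topCoeff (f : Basis (Fin 6) F W) : ExteriorAlgebra F W →ₗ[F] F :=
  liftAlternating (Pi.single 6 f.det)

lemma topCoeff_word (f : Basis (Fin 6) F W) :
    topCoeff f (wordProd (fun i => ι F (f i)) [0, 1, 2, 3, 4, 5]) = 1 := by
  have h : wordProd (fun i => ι F (f i)) [0, 1, 2, 3, 4, 5] =
      ExteriorAlgebra.ιMulti F 6 f := by
    rw [ιMulti_apply]
    simp [wordProd, List.ofFn_succ, List.map_cons]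
  rw [h, topCoeff, liftAlternating_apply_ιMulti, Pi.single_eq_same, f.det_self]

lemma topCoeff_eq_smul (f w : Basis (Fin 6) F W) : topCoeff w = w.det f • topCoeff f := by
  have h := AlternatingMap.eq_smul_basis_det f w.det
  unfold topCoeff
  rw [← map_smul, ← Pi.single_smul, ← h]

/-- The coefficient of a word of length `6` with respect to the sorted word. -/
def topSign (l : List (Fin 6)) : ℤ :=
  if (sortWord l).2 = [0, 1, 2, 3, 4, 5] then (sortWord l).1 else 0

/-- The ordered pairs of distinct letters among six. -/
def letterPairs : List (Fin 6 × Fin 6) :=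
  [(0, 1), (0, 2), (0, 3), (0, 4), (0, 5), (1, 2), (1, 3), (1, 4), (1, 5), (2, 3), (2, 4), (2, 5),
    (3, 4), (3, 5), (4, 5)]

/-- The word of the letters that do not belong to a pair. -/
def complWord (p : Fin 6 × Fin 6) : List (Fin 6) :=
  [0, 1, 2, 3, 4, 5].filter fun i => i ≠ p.1 ∧ i ≠ p.2

/-- Six letters from an alphabet of six either repeat one, which gives coefficient `0`, or form a
permutation. So `topSign` never discards a nonzero term here. -/
lemma sortWord_eq_or : ∀ p ∈ letterPairs, ∀ i j k l : Fin 6, i < j → j < k → k < l →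
    ((sortWord [p.1, p.2, i, j, k, l]).1 = 0 ∨
      (sortWord [p.1, p.2, i, j, k, l]).2 = [0, 1, 2, 3, 4, 5]) := by
  decide +kernel

/-- Only the pair complementary to `{i, j, k, l}` contributes: for it the two signs are equal, and
the remaining word is `[i, j, k, l]` itself. -/
lemma complement_words : ∀ i j k l : Fin 6, i < j → j < k → k < l →
    WordSum.equiv [(1, [i, j, k, l])] (letterPairs.map fun p =>
      (topSign (p.1 :: p.2 :: complWord p) * topSign [p.1, p.2, i, j, k, l], complWord p))
      = true := by
  decide +kernel

lemma topCoeff_wordProd (f : Basis (Fin 6) F W) {l : List (Fin 6)}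
    (h : (sortWord l).1 = 0 ∨ (sortWord l).2 = [0, 1, 2, 3, 4, 5]) :
    topCoeff f (wordProd (fun i => ι F (f i)) l) = (topSign l : F) := by
  rw [wordProd_eq_sortWord (fun _ _ => ι_anticomm _ _) (fun _ => ι_sq_zero _), map_zsmul, topSign]
  rcases h with h | h
  · simp [h]
  · rw [h, if_pos rfl, topCoeff_word]
    simp

lemma eval_map_list {α : Type*} (a : Fin 6 → ExteriorAlgebra F W) (s : List α) (c : α → ℤ)
    (w : α → List (Fin 6)) : WordSum.eval a (s.map fun p => (c p, w p)) =
      (s.map fun p => (c p : F) • wordProd a (w p)).sum := by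
  simp [WordSum.eval, Function.comp_def, Int.cast_smul_eq_zsmul]

/-- A term of the expansion of a four-form by means of its products with two-forms. -/
noncomputable def expansionTerm (f : Basis (Fin 6) F W) (p : Fin 6 × Fin 6) :
    ⋀[F]^4 W →ₗ[F] ExteriorAlgebra F W :=
  ((topSign (p.1 :: p.2 :: complWord p) : F) •
    (topCoeff f ∘ₗ LinearMap.mulLeft F (ι F (f p.1) * ι F (f p.2)) ∘ₗ
      Submodule.subtype _)).smulRight (wordProd (fun i => ι F (f i)) (complWord p))

lemma expansionTerm_apply (f : Basis (Fin 6) F W) (p : Fin 6 × Fin 6) (Ω : ⋀[F]^4 W) :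
    expansionTerm f p Ω = ((topSign (p.1 :: p.2 :: complWord p) : F) *
        topCoeff f (ι F (f p.1) * ι F (f p.2) * (Ω : ExteriorAlgebra F W))) •
        wordProd (fun i => ι F (f i)) (complWord p) := rfl

lemma sum_expansionTerm_apply (f : Basis (Fin 6) F W) (s : List (Fin 6 × Fin 6)) (Ω : ⋀[F]^4 W) :
    (s.map (expansionTerm f)).sum Ω = (s.map fun p => expansionTerm f p Ω).sum := by
  induction s with
  | nil => simp
  | cons p s ih => rw [List.map_cons, List.sum_cons, LinearMap.add_apply, ih]; rfl

/-- Expansion of a four-form in dimension six by means of its products with two-forms. -/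
lemma fourForm_expansion (f : Basis (Fin 6) F W) (Ω : ⋀[F]^4 W) :
    (Ω : ExteriorAlgebra F W) = (letterPairs.map fun p =>
      ((topSign (p.1 :: p.2 :: complWord p) : F) *
        topCoeff f (ι F (f p.1) * ι F (f p.2) * (Ω : ExteriorAlgebra F W))) •
        wordProd (fun i => ι F (f i)) (complWord p)).sum := by
  have key : (Submodule.subtype _ : ⋀[F]^4 W →ₗ[F] ExteriorAlgebra F W) =
      (letterPairs.map (expansionTerm f)).sum := by
    refine (f.exteriorPower 4).ext fun s => ?_
    set i := Set.powersetCard.ofFinEmbEquiv.symm s with hi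
    have hs : (((f.exteriorPower 4) s : ⋀[F]^4 W) : ExteriorAlgebra F W) =
        wordProd (fun i => ι F (f i)) [i 0, i 1, i 2, i 3] := by
      rw [exteriorPower.basis_apply, exteriorPower.ιMulti_family]
      refine (coe_ιMulti_eq_wordProd f i).trans ?_
      simp [List.ofFn_succ]
    have h01 : i 0 < i 1 := i.strictMono (by decide)
    have h12 : i 1 < i 2 := i.strictMono (by decide)
    have h23 : i 2 < i 3 := i.strictMono (by decide)
    have h := WordSum.eval_ι_eq (F := F) f (complement_words _ _ _ _ h01 h12 h23)
    rw [eval_map_list] at h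
    simp only [WordSum.eval_cons, WordSum.eval_nil, one_smul, add_zero] at h
    rw [sum_expansionTerm_apply, Submodule.subtype_apply, hs, h]
    congr 1
    refine List.map_congr_left fun p hp => ?_
    have h6 := topCoeff_wordProd f (sortWord_eq_or p hp _ _ _ _ h01 h12 h23)
    rw [wordProd_cons, wordProd_cons, ← mul_assoc, ← hs] at h6
    rw [expansionTerm_apply, h6, Int.cast_mul]
  have := LinearMap.congr_fun key Ω
  rw [Submodule.subtype_apply, sum_expansionTerm_apply] at this
  exact this

/-- The product of four basis vectors. -/
noncomputable def basisFour (f : Basis (Fin 6) F W) (i j k l : Fin 6) : ⋀[F]^4 W :=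
  exteriorPower.ιMulti F 4 ![f i, f j, f k, f l]

lemma coe_basisFour (f : Basis (Fin 6) F W) (i j k l : Fin 6) :
    (basisFour f i j k l : ExteriorAlgebra F W) = wordProd (fun i => ι F (f i)) [i, j, k, l] := by
  rw [basisFour, exteriorPower.ιMulti_apply_coe, ιMulti_apply]
  simp [wordProd, List.ofFn_succ]

/-- Normal form of four-vectors in dimension six. -/
lemma fourForm_normalForm (hW : finrank F W = 6) (Ω : ⋀[F]^4 W) :
    ∃ (f : Basis (Fin 6) F W) (c : F), c ≠ 0 ∧
      (Ω = 0 ∨ Ω = c • basisFour f 2 3 4 5 ∨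
        Ω = c • (basisFour f 2 3 4 5 + basisFour f 0 1 4 5) ∨
        Ω = c • (basisFour f 2 3 4 5 + basisFour f 0 1 4 5 + basisFour f 0 1 2 3)) := by
  have : FiniteDimensional F W := FiniteDimensional.of_finrank_pos (by omega)
  let w : Basis (Fin 6) F W := finBasisOfFinrankEq F W hW
  -- This alternating form determines `Ω` by `fourForm_expansion`; half its rank will be the number
  -- of terms in the normal form.
  let B : W →ₗ[F] W →ₗ[F] F := LinearMap.mk₂ F
    (fun x y => topCoeff w (ι F x * ι F y * (Ω : ExteriorAlgebra F W)))
    (fun _ _ _ => by simp [add_mul]) (fun _ _ _ => by simp)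
    (fun _ _ _ => by simp [mul_add, add_mul]) (fun _ _ _ => by simp)
  obtain ⟨r, hr, f, hf⟩ := exists_basis_eq_stdAlt 6 hW B (fun x => by simp [B])
  have hd : w.det f ≠ 0 := (w.isUnit_det f).ne_zero
  -- `B` is defined with an auxiliary basis `w`, while the expansion uses the adapted basis `f`. The
  -- change of volume element produces the scalar `c = (w.det f)⁻¹`.
  have hcoef : ∀ i j, topCoeff f (ι F (f i) * ι F (f j) * (Ω : ExteriorAlgebra F W)) =
      (w.det f)⁻¹ * (stdAlt r i j : F) := by
    intro i j
    rw [← hf i j, eq_inv_mul_iff_mul_eq₀ hd]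
    simp only [B, LinearMap.mk₂_apply]
    rw [topCoeff_eq_smul f w, LinearMap.smul_apply, smul_eq_mul]
  refine ⟨f, (w.det f)⁻¹, inv_ne_zero hd, ?_⟩
  have h := fourForm_expansion f Ω
  simp only [hcoef] at h
  have e1 : topSign [0, 1, 2, 3, 4, 5] = 1 ∧ topSign [2, 3, 0, 1, 4, 5] = 1 ∧
      topSign [4, 5, 0, 1, 2, 3] = 1 := by decide +kernel
  have e2 : complWord (0, 1) = [2, 3, 4, 5] ∧ complWord (2, 3) = [0, 1, 4, 5] ∧
    complWord (4, 5) = [0, 1, 2, 3] := by decide +kernel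
  have hrle : r ≤ 3 := by omega
  interval_cases r
  · left
    apply Subtype.ext
    rw [h]
    simp [letterPairs, stdAlt]
  · right; left
    apply Subtype.ext
    rw [h]
    simp [letterPairs, stdAlt, e1, e2, coe_basisFour]
  · right; right; left
    apply Subtype.ext
    rw [h]
    simp [letterPairs, stdAlt, e1, e2, coe_basisFour]
  · right; right; right
    apply Subtype.ext
    rw [h]
    simp [letterPairs, stdAlt, e1, e2, coe_basisFour, add_assoc]

end FourForms

/-! ### The length of four-vectors -/

section Length

variable {F : Type*} {M : Type*} [Field F] [AddCommGroup M] [Module F M]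

lemma kLength_le {k l : ℕ} {X : ⋀[F]^k M} (v : Fin l → Fin k → M)
    (h : X = ∑ i, exteriorPower.ιMulti F k (v i)) : kLength X ≤ l :=
  Nat.sInf_le ⟨v, h⟩

/-- Absorbing the scalar into one factor shows that scalars do not affect the count of decomposable
terms. -/
lemma smul_basisFour (f : Basis (Fin 6) F M) (c : F) (i j k l : Fin 6) :
    c • basisFour f i j k l = exteriorPower.ιMulti F 4 ![c • f i, f j, f k, f l] := by
  have h := (exteriorPower.ιMulti F 4).map_update_smul ![f i, f j, f k, f l] 0 c (f i)
  have e : ∀ x : M, Function.update ![f i, f j, f k, f l] 0 x = ![x, f j, f k, f l] := by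
    intro x
    ext a
    fin_cases a <;> rfl
  rw [e, e] at h
  exact h.symm

/-- A four-vector in dimension six of length at least `m` is a combination of at least `m` terms
of the normal form; its length is at most three. -/
lemma kLength_normalForm (hW : finrank F M = 6) (Ω : ⋀[F]^4 M) :
    (∃ v : Fin 3 → Fin 4 → M, Ω = ∑ i, exteriorPower.ιMulti F 4 (v i)) ∧
    (2 ≤ kLength Ω → ∃ (f : Basis (Fin 6) F M) (c : F), c ≠ 0 ∧
      (Ω = c • (basisFour f 2 3 4 5 + basisFour f 0 1 4 5) ∨
        Ω = c • (basisFour f 2 3 4 5 + basisFour f 0 1 4 5 + basisFour f 0 1 2 3))) ∧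
    (3 ≤ kLength Ω → ∃ (f : Basis (Fin 6) F M) (c : F), c ≠ 0 ∧
      Ω = c • (basisFour f 2 3 4 5 + basisFour f 0 1 4 5 + basisFour f 0 1 2 3)) := by
  obtain ⟨f, c, hc, h⟩ := fourForm_normalForm hW Ω
  have hle : ∀ l, (∃ v : Fin l → Fin 4 → M, Ω = ∑ i, exteriorPower.ιMulti F 4 (v i)) →
    kLength Ω ≤ l := fun l ⟨v, hv⟩ => kLength_le v hv
  have hzero : exteriorPower.ιMulti F 4 (0 : Fin 4 → M) = 0 := AlternatingMap.map_zero _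
  rcases h with h | h | h | h
  · have h0 : kLength Ω ≤ 0 := hle 0 ⟨Fin.elim0, by simp [h]⟩
    -- Missing summands are padded with the zero family. The claims about larger lengths are vacuous
    -- by the upper bound just found.
    exact ⟨⟨0, by simp [h, hzero]⟩, fun _ => by omega, fun _ => by omega⟩
  · rw [smul_basisFour] at h
    have h0 : kLength Ω ≤ 1 := hle 1 ⟨![_], by simpa using h⟩
    refine ⟨⟨![![c • f 2, f 3, f 4, f 5], 0, 0], ?_⟩, fun _ => by omega, fun _ => by omega⟩
    rw [h, Fin.sum_univ_three]
    simp [hzero]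
  · have h' := h
    rw [smul_add, smul_basisFour, smul_basisFour] at h'
    have h0 : kLength Ω ≤ 2 := hle 2 ⟨![_, _], by simpa [Fin.sum_univ_two] using h'⟩
    refine ⟨⟨![![c • f 2, f 3, f 4, f 5], ![c • f 0, f 1, f 4, f 5], 0], ?_⟩,
      fun _ => ⟨f, c, hc, Or.inl h⟩, fun _ => by omega⟩
    rw [h', Fin.sum_univ_three]
    simp [hzero]
  · refine ⟨?_, fun _ => ⟨f, c, hc, Or.inr h⟩, fun _ => ⟨f, c, hc, h⟩⟩
    rw [smul_add, smul_add, smul_basisFour, smul_basisFour, smul_basisFour] at h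
    exact ⟨![_, _, _], by simpa [Fin.sum_univ_three] using h⟩

/-- A lower bound for the length. -/
lemma le_kLength {k l m : ℕ} {X : ⋀[F]^k M} (v : Fin l → Fin k → M)
    (hv : X = ∑ i, exteriorPower.ιMulti F k (v i))
    (h : ∀ (n : ℕ) (v : Fin n → Fin k → M), X = ∑ i, exteriorPower.ιMulti F k (v i) → m ≤ n) :
    m ≤ kLength X := by
  -- Some representation must exist, since the infimum of the empty set would be `0`.
  have hne : {l : ℕ | ∃ v : Fin l → Fin k → M, X = ∑ i, exteriorPower.ιMulti F k (v i)}.Nonempty :=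
    ⟨l, v, hv⟩
  obtain ⟨u, hu⟩ := Nat.sInf_mem hne
  exact h _ u hu

end Length

/-! ### Kernels of wedge pairings of five-vectors -/

section Kernel

variable {F : Type*} {W : Type*} [Field F] [AddCommGroup W] [Module F W]

open ExteriorAlgebra

/-- The vectors `x` with `x ∧ y ∧ X = 0` for all `y`. -/
def wedgeKernel (X : ExteriorAlgebra F W) : Submodule F W where
  carrier := {x | ∀ y, ι F x * ι F y * X = 0}
  add_mem' ha hb y := by rw [map_add, add_mul, add_mul, ha y, hb y, add_zero]
  zero_mem' y := by simp
  smul_mem' c x hx y := by rw [map_smul, smul_mul_assoc, smul_mul_assoc, hx y, smul_zero]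

/-- If the factors are independent, each of them annihilates the product, so their span lies in the
kernel; otherwise the product is zero and the kernel is everything. -/
lemma five_le_finrank_wedgeKernel (hW : finrank F W = 7) (u : Fin 5 → W) :
    5 ≤ finrank F (wedgeKernel (ExteriorAlgebra.ιMulti F 5 u)) := by
  have : FiniteDimensional F W := FiniteDimensional.of_finrank_pos (by omega)
  by_cases h : LinearIndependent F u
  · have hle : Submodule.span F (Set.range u) ≤ wedgeKernel (ExteriorAlgebra.ιMulti F 5 u) := by
      rw [Submodule.span_le]
      rintro _ ⟨i, rfl⟩ y
      have h7 : ι F (u i) * ι F y * ExteriorAlgebra.ιMulti F 5 u =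
          ExteriorAlgebra.ιMulti F 7 (Fin.cons (u i) (Fin.cons y u) : Fin 7 → W) := by
        rw [ExteriorAlgebra.ιMulti_succ_apply, ExteriorAlgebra.ιMulti_succ_apply, mul_assoc]
        rfl
      rw [h7]
      exact AlternatingMap.map_eq_zero_of_eq _ _ (i := 0) (j := i.succ.succ)
        (by simp) (Fin.succ_ne_zero _).symm
    have := Submodule.finrank_mono hle
    rwa [finrank_span_eq_card h, Fintype.card_fin] at this
  · have h0 : ExteriorAlgebra.ιMulti F 5 u = 0 := AlternatingMap.map_linearDependent _ _ h
    have : wedgeKernel (ExteriorAlgebra.ιMulti F 5 u) = ⊤ := by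
      rw [h0, eq_top_iff]
      intro x _ y
      rw [mul_zero]
    rw [this, finrank_top, hW]
    norm_num

/-- Each decomposable summand has a kernel of codimension at most two, and the kernel of the sum
contains the intersection of these kernels. -/
lemma finrank_wedgeKernel_sum (hW : finrank F W = 7) (l : ℕ) (u : Fin l → Fin 5 → W) :
    7 ≤ finrank F (wedgeKernel (∑ i, ExteriorAlgebra.ιMulti F 5 (u i))) + 2 * l := by
  have : FiniteDimensional F W := FiniteDimensional.of_finrank_pos (by omega)
  induction l with
  | zero =>
    have : wedgeKernel (∑ i : Fin 0, ExteriorAlgebra.ιMulti F 5 (u i)) = ⊤ := by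
      rw [eq_top_iff]
      intro x _ y
      simp
    rw [this, finrank_top, hW]
  | succ l ih =>
    have h1 := ih fun i => u i.castSucc
    have h2 := five_le_finrank_wedgeKernel hW (u (Fin.last l))
    have hle : wedgeKernel (∑ i : Fin l, ExteriorAlgebra.ιMulti F 5 (u i.castSucc)) ⊓
        wedgeKernel (ExteriorAlgebra.ιMulti F 5 (u (Fin.last l))) ≤
        wedgeKernel (∑ i, ExteriorAlgebra.ιMulti F 5 (u i)) := by
      rintro x ⟨hx, hx'⟩ y
      rw [Fin.sum_univ_castSucc, mul_add, hx y, hx' y, add_zero]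
    have h3 := Submodule.finrank_mono hle
    have h4 := Submodule.finrank_sup_add_finrank_inf_eq
      (wedgeKernel (∑ i : Fin l, ExteriorAlgebra.ιMulti F 5 (u i.castSucc)))
      (wedgeKernel (ExteriorAlgebra.ιMulti F 5 (u (Fin.last l))))
    have h5 := Submodule.finrank_le
      (wedgeKernel (∑ i : Fin l, ExteriorAlgebra.ιMulti F 5 (u i.castSucc)) ⊔
      wedgeKernel (ExteriorAlgebra.ιMulti F 5 (u (Fin.last l))))
    omega

lemma ιMulti_mul_ι {k : ℕ} (v : Fin k → W) (η : W) :
    ExteriorAlgebra.ιMulti F k v * ι F η =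
      ExteriorAlgebra.ιMulti F (k + 1) (Fin.snoc v η : Fin (k + 1) → W) := by
  simp only [ιMulti_apply]
  rw [List.ofFn_succ', List.prod_concat]
  simp

end Kernel

/-! ### The cross product and its rank -/

section CrossMatrix

/-- The matrix of `n ⌟ φ_ε`, with raised indices. -/
def crossMatrix {R : Type*} [CommRing R] (ε : R) (n : Fin 7 → R) : Matrix (Fin 7) (Fin 7) R :=
  !![0, ε * n 6, n 4, -n 5, -n 2, n 3, -ε * n 1;
    -ε * n 6, 0, -n 5, -n 4, n 3, n 2, ε * n 0;
    -n 4, n 5, 0, ε * n 6, n 0, -n 1, -ε * n 3;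
    n 5, n 4, -ε * n 6, 0, -n 1, -n 0, ε * n 2;
    n 2, -n 3, -n 0, n 1, 0, n 6, -n 5;
    -n 3, -n 2, n 1, n 0, -n 6, 0, n 4;
    ε * n 1, -ε * n 0, ε * n 3, -ε * n 2, n 5, -n 4, 0]

/-- This identifies `(x, y) ↦ x ∧ y ∧ ⋆φ_ε ∧ n`, as a multiple of the volume form, with the matrix
of the cross product by `n`. -/
lemma cross_words {ε : ℤ} (hε : ε = 1 ∨ ε = -1) (i j k : Fin 7) :
    WordSum.equiv (WordSum.mul [(1, [i, j])] ((starWords ε).mul [(1, [k])]))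
      [(crossMatrix ε (fun l => if l = k then 1 else 0) i j, [0, 1, 2, 3, 4, 5, 6])] = true := by
  revert i j k
  rcases hε with rfl | rfl <;> decide +kernel

variable {F : Type*} [Field F]

lemma crossMatrix_eq_sum (ε : ℤ) (n : Fin 7 → F) (i j : Fin 7) :
    crossMatrix (ε : F) n i j =
      ∑ k, n k * ((crossMatrix ε (fun l => if l = k then 1 else 0) i j : ℤ) : F) := by
  fin_cases i <;> fin_cases j <;> simp [crossMatrix, mul_comm]

lemma crossMatrix_skew (ε : F) (n : Fin 7 → F) (i j : Fin 7) :
    crossMatrix ε n i j = -crossMatrix ε n j i := by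
  fin_cases i <;> fin_cases j <;> simp [crossMatrix]

/-- The double cross product identity. -/
lemma crossMatrix_double {ε : F} (hε : ε = 1 ∨ ε = -1) (n x : Fin 7 → F)
    (h : ∀ j, ∑ i, x i * crossMatrix ε n i j = 0) (m : Fin 7) :
    (ε * (n 0 ^ 2 + n 1 ^ 2 + n 2 ^ 2 + n 3 ^ 2) + n 4 ^ 2 + n 5 ^ 2 + n 6 ^ 2) * x m =
      (ε * (n 0 * x 0 + n 1 * x 1 + n 2 * x 2 + n 3 * x 3) + n 4 * x 4 + n 5 * x 5 + n 6 * x 6) *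
        n m := by
  have h0 := h 0
  have h1 := h 1
  have h2 := h 2
  have h3 := h 3
  have h4 := h 4
  have h5 := h 5
  have h6 := h 6
  -- The hypothesis is crossed with `n` a second time: the coefficients for index `m` below are the
  -- entries of row `m` of `crossMatrix`, up to the signs of the metric.
  rcases hε with rfl | rfl <;> simp [Fin.sum_univ_succ, crossMatrix] at h0 h1 h2 h3 h4 h5 h6 ⊢
  · fin_cases m
    · change _ * x 0 = _ * n 0
      linear_combination n 6 * h1 + n 4 * h2 - n 5 * h3 - n 2 * h4 + n 3 * h5 - n 1 * h6
    · change _ * x 1 = _ * n 1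
      linear_combination - n 6 * h0 - n 5 * h2 - n 4 * h3 + n 3 * h4 + n 2 * h5 + n 0 * h6
    · change _ * x 2 = _ * n 2
      linear_combination - n 4 * h0 + n 5 * h1 + n 6 * h3 + n 0 * h4 - n 1 * h5 - n 3 * h6
    · change _ * x 3 = _ * n 3
      linear_combination n 5 * h0 + n 4 * h1 - n 6 * h2 - n 1 * h4 - n 0 * h5 + n 2 * h6
    · change _ * x 4 = _ * n 4
      linear_combination n 2 * h0 - n 3 * h1 - n 0 * h2 + n 1 * h3 + n 6 * h5 - n 5 * h6
    · change _ * x 5 = _ * n 5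
      linear_combination - n 3 * h0 - n 2 * h1 + n 1 * h2 + n 0 * h3 - n 6 * h4 + n 4 * h6
    · change _ * x 6 = _ * n 6
      linear_combination n 1 * h0 - n 0 * h1 + n 3 * h2 - n 2 * h3 + n 5 * h4 - n 4 * h5
  · fin_cases m
    · change _ * x 0 = _ * n 0
      linear_combination - n 6 * h1 + n 4 * h2 - n 5 * h3 + n 2 * h4 - n 3 * h5 - n 1 * h6
    · change _ * x 1 = _ * n 1
      linear_combination n 6 * h0 - n 5 * h2 - n 4 * h3 - n 3 * h4 - n 2 * h5 + n 0 * h6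
    · change _ * x 2 = _ * n 2
      linear_combination - n 4 * h0 + n 5 * h1 - n 6 * h3 - n 0 * h4 + n 1 * h5 - n 3 * h6
    · change _ * x 3 = _ * n 3
      linear_combination n 5 * h0 + n 4 * h1 + n 6 * h2 + n 1 * h4 + n 0 * h5 + n 2 * h6
    · change _ * x 4 = _ * n 4
      linear_combination - n 2 * h0 + n 3 * h1 + n 0 * h2 - n 1 * h3 + n 6 * h5 - n 5 * h6
    · change _ * x 5 = _ * n 5
      linear_combination n 3 * h0 + n 2 * h1 - n 1 * h2 - n 0 * h3 - n 6 * h4 + n 4 * h6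
    · change _ * x 6 = _ * n 6
      linear_combination n 1 * h0 - n 0 * h1 + n 3 * h2 - n 2 * h3 + n 5 * h4 - n 4 * h5

/-- If the kernel has codimension at most two, the Pfaffians of order four vanish. -/
lemma pfaffian_eq_zero {W : Type*} [AddCommGroup W] [Module F W] [FiniteDimensional F W]
    {n : ℕ} (c : Basis (Fin n) F W) {A : Matrix (Fin n) (Fin n) F} (hA : ∀ i j, A i j = -A j i)
    (hA' : ∀ i, A i i = 0) {K : Submodule F W} (hK : ∀ x ∈ K, ∀ j, ∑ i, c.repr x i * A i j = 0)
    (hdim : finrank F W ≤ finrank F K + 2) (i j k l : Fin n) :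
    A i j * A k l - A i k * A j l + A i l * A j k = 0 := by
  have hq := K.finrank_quotient_add_finrank
  -- Three vectors in a quotient of dimension at most two are dependent, so rows `i`, `j`, `k` of
  -- `A` satisfy a nontrivial linear relation.
  have hdep : ¬ LinearIndependent F (K.mkQ ∘ c ∘ ![i, j, k]) := fun h => by
    have := h.fintype_card_le_finrank
    rw [Fintype.card_fin] at this
    omega
  rw [Fintype.not_linearIndependent_iff] at hdep
  obtain ⟨g, hg, hne⟩ := hdep
  simp only [Fin.sum_univ_three, Function.comp_apply, ← map_smul, ← map_add] at hg
  have hmem := (Submodule.Quotient.mk_eq_zero K).1 hg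
  have hrow : ∀ m, g 0 * A i m + g 1 * A j m + g 2 * A k m = 0 := by
    intro m
    have := hK _ hmem m
    simp only [map_add, map_smul, Finsupp.add_apply, Finsupp.smul_apply, add_mul, smul_eq_mul,
      Finset.sum_add_distrib, mul_assoc, ← Finset.mul_sum, Matrix.cons_val_zero,
      Matrix.cons_val_one, Matrix.cons_val_two, Basis.repr_self] at this
    simpa [Finsupp.single_apply] using this
  have e1 := hrow i
  have e2 := hrow j
  have e3 := hrow k
  have e4 := hrow l
  rw [hA' i, hA j i, hA k i] at e1
  rw [hA' j, hA k j] at e2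
  rw [hA' k] at e3
  obtain ⟨a, ha⟩ := hne
  -- The row relation makes a nonzero coefficient times the Pfaffian vanish.
  refine (mul_eq_zero.1 (?_ : g a * _ = 0)).resolve_left ha
  fin_cases a
  · show g 0 * _ = 0
    linear_combination A j k * e4 - A j l * e3 + A k l * e2
  · show g 1 * _ = 0
    linear_combination A i l * e3 - A i k * e4 - A k l * e1
  · show g 2 * _ = 0
    linear_combination A i j * e4 - A i l * e2 + A j l * e1

/-- The triples are the lines of the Fano plane, the index sets of `φ`. All seven lines sum to three
times the total, and the three lines through a point sum to the total plus twice the weight of that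
point. -/
lemma eq_zero_of_sum_lines [CharZero F] (w : Fin 7 → F) (h₁ : w 0 + w 1 + w 6 = 0)
    (h₂ : w 2 + w 3 + w 6 = 0) (h₃ : w 4 + w 5 + w 6 = 0) (h₄ : w 0 + w 2 + w 4 = 0)
    (h₅ : w 0 + w 3 + w 5 = 0) (h₆ : w 1 + w 2 + w 5 = 0) (h₇ : w 1 + w 3 + w 4 = 0) (i : Fin 7) :
    w i = 0 := by
  have h : w 0 + w 1 + w 2 + w 3 + w 4 + w 5 + w 6 = 0 := by
    linear_combination (h₁ + h₂ + h₃ + h₄ + h₅ + h₆ + h₇) / 3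
  fin_cases i
  · show w 0 = 0
    linear_combination (h₁ + h₄ + h₅ - h) / 2
  · show w 1 = 0
    linear_combination (h₁ + h₆ + h₇ - h) / 2
  · show w 2 = 0
    linear_combination (h₂ + h₄ + h₆ - h) / 2
  · show w 3 = 0
    linear_combination (h₂ + h₅ + h₇ - h) / 2
  · show w 4 = 0
    linear_combination (h₃ + h₄ + h₇ - h) / 2
  · show w 5 = 0
    linear_combination (h₃ + h₅ + h₆ - h) / 2
  · show w 6 = 0
    linear_combination (h₁ + h₂ + h₃ - h) / 2

/-- The cross product with a nonzero vector has rank at least four. -/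
lemma eq_zero_of_pfaffians [CharZero F] {ε : F} (hε : ε = 1 ∨ ε = -1) (n : Fin 7 → F)
    (h : ∀ i j k l, crossMatrix ε n i j * crossMatrix ε n k l
      - crossMatrix ε n i k * crossMatrix ε n j l
      + crossMatrix ε n i l * crossMatrix ε n j k = 0) (m : Fin 7) : n m = 0 := by
  -- The seven quadruples are the index sets of `⋆φ`, hence complements of Fano lines. Up to sign,
  -- each Pfaffian is the sum over the complementary line of the weights `±n_m²`, with the signs of
  -- the metric.
  have p1 := h 2 3 4 5
  have p2 := h 0 1 4 5
  have p3 := h 0 1 2 3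
  have p4 := h 1 3 5 6
  have p5 := h 1 2 4 6
  have p6 := h 0 3 4 6
  have p7 := h 0 2 5 6
  clear h
  suffices ∀ m, (if m < 4 then ε else 1) * (n m * n m) = 0 by
    have h2 := this m
    rcases hε with rfl | rfl <;> split_ifs at h2 <;> simpa using h2
  rcases hε with rfl | rfl <;> simp [crossMatrix] at p1 p2 p3 p4 p5 p6 p7
  · intro m
    refine eq_zero_of_sum_lines (fun m : Fin 7 => (if m < 4 then (1 : F) else 1) * (n m * n m))
      ?_ ?_ ?_ ?_ ?_ ?_ ?_ m <;> simp
    · linear_combination p1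
    · linear_combination p2
    · linear_combination p3
    · linear_combination -p4
    · linear_combination p5
    · linear_combination p6
    · linear_combination p7
  · intro m
    refine eq_zero_of_sum_lines (fun m : Fin 7 => (if m < 4 then (-1 : F) else 1) * (n m * n m))
      ?_ ?_ ?_ ?_ ?_ ?_ ?_ m <;> simp
    · linear_combination -p1
    · linear_combination -p2
    · linear_combination p3
    · linear_combination -p4
    · linear_combination p5
    · linear_combination p6
    · linear_combination p7

end CrossMatrix

/-! ### Lower bounds for the length of the component of `⋆φ` -/

section Star

variable {F : Type*} {V : Type*} [Field F] [AddCommGroup V] [Module F V]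

open ExteriorAlgebra

lemma ι_mul_ι_mul_starForm {ε : ℤ} (hε : ε = 1 ∨ ε = -1) (b : Basis (Fin 7) F V)
    (x η : Dual F V) (j : Fin 7) :
    ι F x * ι F (b.coord j) * ((starForm ε b : ExteriorAlgebra F (Dual F V)) * ι F η) =
      (∑ i, x (b i) * crossMatrix (ε : F) (fun k => η (b k)) i j) •
        (volForm b : ExteriorAlgebra F (Dual F V)) := by
  have key : ∀ i k, ι F (b.coord i) * ι F (b.coord j) *
      ((starForm ε b : ExteriorAlgebra F (Dual F V)) * ι F (b.coord k)) =
      ((crossMatrix ε (fun l => if l = k then 1 else 0) i j : ℤ) : F) •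
        (volForm b : ExteriorAlgebra F (Dual F V)) := by
    intro i k
    have h := WordSum.eval_ι_eq (F := F) (fun i => b.coord i) (cross_words hε i j k)
    rw [WordSum.eval_mul, WordSum.eval_mul, ← coe_starForm] at h
    rw [coe_volForm]
    simpa [Int.cast_smul_eq_zsmul] using h
  conv_lhs => rw [← b.sum_dual_apply_smul_coord x, ← b.sum_dual_apply_smul_coord η]
  simp only [map_sum, map_smul, Finset.sum_mul, Finset.mul_sum, smul_mul_assoc, mul_smul_comm, key,
    crossMatrix_eq_sum, Finset.sum_smul, smul_smul]
  simp only [Finset.smul_sum, smul_smul]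
  rw [Finset.sum_comm]
  refine Finset.sum_congr rfl fun i _ => Finset.sum_congr rfl fun k _ => ?_
  congr 1
  ring

lemma sum_crossMatrix_of_mem {ε : ℤ} (hε : ε = 1 ∨ ε = -1) (b : Basis (Fin 7) F V)
    {x η : Dual F V}
    (hx : x ∈ wedgeKernel ((starForm ε b : ExteriorAlgebra F (Dual F V)) * ι F η)) (j : Fin 7) :
    ∑ i, x (b i) * crossMatrix (ε : F) (fun k => η (b k)) i j = 0 := by
  have h := hx (b.coord j)
  rw [ι_mul_ι_mul_starForm hε] at h
  exact (smul_eq_zero.1 h).resolve_right (volForm_ne_zero b)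

/-- The square norm of a one-form with respect to the metric induced by `φ_ε`. -/
def coordNorm (ε : ℤ) (n : Fin 7 → F) : F :=
  ε * (n 0 ^ 2 + n 1 ^ 2 + n 2 ^ 2 + n 3 ^ 2) + n 4 ^ 2 + n 5 ^ 2 + n 6 ^ 2

lemma cast_sign {ε : ℤ} (hε : ε = 1 ∨ ε = -1) : (ε : F) = 1 ∨ (ε : F) = -1 := by
  rcases hε with rfl | rfl <;> simp

/-- For `x` in the kernel, the double cross product identity makes a nonzero multiple of `x` a
multiple of `η`. -/
lemma finrank_wedgeKernel_star_le_one {ε : ℤ} (hε : ε = 1 ∨ ε = -1) (b : Basis (Fin 7) F V)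
    {η : Dual F V} (hN : coordNorm ε (fun k => η (b k)) ≠ 0) :
    finrank F (wedgeKernel ((starForm ε b : ExteriorAlgebra F (Dual F V)) * ι F η)) ≤ 1 := by
  have := Module.Finite.of_basis b
  have hle : wedgeKernel ((starForm ε b : ExteriorAlgebra F (Dual F V)) * ι F η) ≤
      Submodule.span F {η} := by
    intro x hx
    obtain ⟨t, ht⟩ : ∃ t, ∀ m, coordNorm ε (fun k => η (b k)) * x (b m) = t * η (b m) :=
      ⟨_, crossMatrix_double (cast_sign hε) (fun k => η (b k)) (fun k => x (b k))
      (sum_crossMatrix_of_mem hε b hx)⟩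
    rw [Submodule.mem_span_singleton]
    refine ⟨(coordNorm ε fun k => η (b k))⁻¹ * t, (b.ext fun m => ?_).symm⟩
    rw [LinearMap.smul_apply, smul_eq_mul, mul_assoc]
    exact (eq_inv_mul_iff_mul_eq₀ hN).2 (ht m)
  have h1 := finrank_span_le_card (R := F) ({η} : Set (Dual F V))
  exact (Submodule.finrank_mono hle).trans (by simpa using h1)

/-- A kernel of dimension five or more has codimension at most two, so all Pfaffians of order four
would vanish and force `η = 0`. -/
lemma finrank_wedgeKernel_star_le_four [CharZero F] {ε : ℤ} (hε : ε = 1 ∨ ε = -1)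
    (b : Basis (Fin 7) F V) {η : Dual F V} (hη : η ≠ 0) :
    finrank F (wedgeKernel ((starForm ε b : ExteriorAlgebra F (Dual F V)) * ι F η)) ≤ 4 := by
  have := Module.Finite.of_basis b
  by_contra! h
  apply hη
  refine b.ext fun m => ?_
  refine eq_zero_of_pfaffians (cast_sign hε) (fun k => η (b k)) (fun i j k l => ?_) m
  refine pfaffian_eq_zero b.dualBasis (crossMatrix_skew _ _) ?_ (K := wedgeKernel
    ((starForm ε b : ExteriorAlgebra F (Dual F V)) * ι F η)) (fun x hx j => ?_) ?_ i j k l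
  · intro i
    fin_cases i <;> simp [crossMatrix]
  · simpa using sum_crossMatrix_of_mem hε b hx j
  · rw [Subspace.dual_finrank_eq, finrank_eq_card_basis b, Fintype.card_fin]
    omega

lemma mul_ι_eq_zero_of_mem_multiplesOf {η : Dual F V} {k : ℕ} {χ : Form F V k}
    (h : χ ∈ multiplesOf η k) : (χ : ExteriorAlgebra F (Dual F V)) * ι F η = 0 := by
  induction h using Submodule.span_induction with
  | mem x hx =>
    obtain ⟨v, ⟨i, hi⟩, rfl⟩ := hx
    rw [exteriorPower.ιMulti_apply_coe, ιMulti_mul_ι]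
    exact AlternatingMap.map_eq_zero_of_eq _ _ (i := i.castSucc) (j := Fin.last k)
      (by simp [hi]) (Fin.castSucc_lt_last i).ne
  | zero => simp
  | add x y _ _ hx hy => simp [add_mul, hx, hy]
  | smul c x _ hx => simp [hx]

variable {e : V} {η : Dual F V}

/-- Wedging with `η` kills the part of `χ` divisible by `η`, so `χ ∧ η` is a sum of as many
decomposable five-vectors as are used for the annihilator component. -/
lemma seven_le_finrank_wedgeKernel (hV : finrank F V = 7) (he : η e = 1) (χ : Form F V 4) {l : ℕ}
    (v : Fin l → Fin 4 → Submodule.dualAnnihilator (Submodule.span F {e}))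
    (hv : annPart he χ = ∑ i, exteriorPower.ιMulti F 4 (v i)) :
    7 ≤ finrank F (wedgeKernel ((χ : ExteriorAlgebra F (Dual F V)) * ι F η)) + 2 * l := by
  have h := mul_ι_eq_zero_of_mem_multiplesOf (sub_annForm_mem_multiplesOf he χ)
  rw [hv, Submodule.coe_sub, sub_mul, sub_eq_zero, annForm_sum, Submodule.coe_sum,
    Finset.sum_mul] at h
  have h' : ∀ i, (annForm (exteriorPower.ιMulti F 4 (v i)) : ExteriorAlgebra F (Dual F V)) * ι F η =
      ExteriorAlgebra.ιMulti F 5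
        (Fin.snoc (fun j => (v i j : Dual F V)) η : Fin 5 → Dual F V) := fun i => by
    rw [annForm_ιMulti]
    exact ιMulti_mul_ι _ _
  rw [h, Finset.sum_congr rfl fun i _ => h' i]
  exact finrank_wedgeKernel_sum (by rw [Subspace.dual_finrank_eq, hV]) l _

lemma finrank_dualAnnihilator_eq_six (hV : finrank F V = 7) (he : η e = 1) :
    finrank F (Submodule.dualAnnihilator (Submodule.span F {e})) = 6 := by
  have : FiniteDimensional F V := FiniteDimensional.of_finrank_pos (by omega)
  have hne : e ≠ 0 := by
    rintro rfl
    simp at he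
  have h := Subspace.finrank_add_finrank_dualAnnihilator_eq (Submodule.span F {e})
  rw [finrank_span_singleton hne, hV] at h
  omega

lemma two_le_kLength_star [CharZero F] (hV : finrank F V = 7) (he : η e = 1) {ε : ℤ}
    (hε : ε = 1 ∨ ε = -1) (b : Basis (Fin 7) F V) :
    2 ≤ kLength (annPart he (starForm ε b)) := by
  obtain ⟨v, hv⟩ := (kLength_normalForm (finrank_dualAnnihilator_eq_six hV he)
    (annPart he (starForm ε b))).1
  refine le_kLength v hv fun n u hu => ?_
  have h1 := seven_le_finrank_wedgeKernel hV he _ u hu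
  have hη : η ≠ 0 := by
    rintro rfl
    simp at he
  have h2 := finrank_wedgeKernel_star_le_four hε b hη
  -- `7 ≤ 4 + 2n` already forces `n ≥ 2`.
  omega

lemma kLength_star_eq_three (hV : finrank F V = 7) (he : η e = 1) {ε : ℤ}
    (hε : ε = 1 ∨ ε = -1) (b : Basis (Fin 7) F V) (hN : coordNorm ε (fun k => η (b k)) ≠ 0) :
    kLength (annPart he (starForm ε b)) = 3 := by
  obtain ⟨v, hv⟩ := (kLength_normalForm (finrank_dualAnnihilator_eq_six hV he)
    (annPart he (starForm ε b))).1
  refine le_antisymm (kLength_le v hv) (le_kLength v hv fun n u hu => ?_)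
  have h1 := seven_le_finrank_wedgeKernel hV he _ u hu
  have h2 := finrank_wedgeKernel_star_le_one hε b hN
  -- `7 ≤ 1 + 2n` forces `n ≥ 3`.
  omega

end Star

/-! ### Adapted bases from normal forms -/

section Cobasis

variable {F : Type*} {V : Type*} [Field F] [AddCommGroup V] [Module F V]

open ExteriorAlgebra

lemma exists_basis_coord_eq [FiniteDimensional F V] (c : Basis (Fin 7) F (Dual F V)) :
    ∃ b : Basis (Fin 7) F V, ∀ i, b.coord i = c i := by
  refine ⟨c.dualBasis.map (evalEquiv F V).symm, fun i => ?_⟩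
  refine (c.dualBasis.map (evalEquiv F V).symm).ext fun j => ?_
  rw [Basis.coord_apply, Basis.repr_self, Basis.map_apply, apply_evalEquiv_symm_apply,
    Basis.coe_dualBasis, Basis.coord_apply, Basis.repr_self]
  by_cases h : i = j
  · simp [h]
  · simp [h, Ne.symm h]

variable {e : V} {η : Dual F V}

/-- Seven one-forms whose span contains `η` and a basis of the annihilator of `e` are the dual
basis of a basis. -/
lemma exists_basis_coord_eq_of_span (hV : finrank F V = 7) (he : η e = 1)
    (f : Basis (Fin 6) F (Submodule.dualAnnihilator (Submodule.span F {e})))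
    (v : Fin 7 → Dual F V) (hη : η ∈ Submodule.span F (Set.range v))
    (hf : ∀ i, (f i : Dual F V) ∈ Submodule.span F (Set.range v)) :
    ∃ b : Basis (Fin 7) F V, ∀ i, b.coord i = v i := by
  have : FiniteDimensional F V := FiniteDimensional.of_finrank_pos (by omega)
  have hspan : ⊤ ≤ Submodule.span F (Set.range v) := by
    intro α _
    have h : α = (annProj he α : Dual F V) + α e • η := by simp [coe_annProj]
    rw [h]
    refine add_mem ?_ (Submodule.smul_mem _ _ hη)
    rw [← f.sum_repr (annProj he α), Submodule.coe_sum]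
    exact sum_mem fun i _ => Submodule.smul_mem _ _ (hf i)
  obtain ⟨b, hb⟩ := exists_basis_coord_eq
    (basisOfTopLeSpanOfCardEqFinrank v hspan (by simp [Subspace.dual_finrank_eq, hV]))
  refine ⟨b, fun i => ?_⟩
  rw [hb, coe_basisOfTopLeSpanOfCardEqFinrank]

lemma annForm_basisFour (f : Basis (Fin 6) F (Submodule.dualAnnihilator (Submodule.span F {e})))
    (i j k l : Fin 6) : (annForm (basisFour f i j k l) : ExteriorAlgebra F (Dual F V)) =
      ι F (f i : Dual F V) * (ι F (f j : Dual F V) * (ι F (f k : Dual F V) *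
        ι F (f l : Dual F V))) := by
  have h : annForm (basisFour f i j k l) =
    exteriorPower.ιMulti F 4 fun a => ((![f i, f j, f k, f l] a : _) : Dual F V) :=
    annForm_ιMulti _
  rw [h, exteriorPower.ιMulti_apply_coe, ιMulti_apply]
  simp [List.ofFn_succ]

/-- A four-form of length three is, up to multiples of `η`, the Hodge dual of a structure. -/
lemma exists_starForm_of_three (hV : finrank F V = 7) (he : η e = 1) {ε : ℤ}
    (hε : ε = 1 ∨ ε = -1)
    (f : Basis (Fin 6) F (Submodule.dualAnnihilator (Submodule.span F {e}))) :
    ∃ b : Basis (Fin 7) F V, b.coord 6 = η ∧ (∀ i : Fin 6, b i.castSucc ∈ LinearMap.ker η) ∧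
      starForm ε b - annForm (basisFour f 2 3 4 5 + basisFour f 0 1 4 5 + basisFour f 0 1 2 3) ∈
        multiplesOf η 4 := by
  have hεε : (ε : F) * ε = 1 := by
    rcases hε with rfl | rfl <;> simp
  -- The factor `ε` on `f 4` cancels the `ε` in the two terms of `⋆φ_ε` that contain `e⁵` but not
  -- `e⁷`, because `ε² = 1`.
  set v : Fin 7 → Dual F V := ![f 0, f 1, f 2, f 3, (ε : F) • (f 4 : Dual F V), f 5, η] with hv
  have hmem : ∀ i, v i ∈ Submodule.span F (Set.range v) := fun i => Submodule.subset_span ⟨i, rfl⟩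
  obtain ⟨b, hb⟩ := exists_basis_coord_eq_of_span hV he f v (hmem 6) (by
    intro i
    fin_cases i
    · exact hmem 0
    · exact hmem 1
    · exact hmem 2
    · exact hmem 3
    · have := Submodule.smul_mem _ (ε : F) (hmem 4)
      simpa [hv, smul_smul, hεε] using this
    · exact hmem 5)
  have h6 : b.coord 6 = η := hb 6
  refine ⟨b, h6, fun i => ?_, ?_⟩
  · rw [LinearMap.mem_ker, ← h6]
    simp
    fin_cases i <;> simp
  · have hmult : ∀ i j k : Fin 7, mono b ![i, j, k, 6] ∈ multiplesOf η 4 := fun i j k =>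
      ιMulti_mem_multiplesOf (i := 3) h6
    have hstar : starForm ε b =
        annForm (basisFour f 2 3 4 5 + basisFour f 0 1 4 5 + basisFour f 0 1 2 3) +
        (- mono b ![1, 3, 5, 6] + mono b ![1, 2, 4, 6] + mono b ![0, 3, 4, 6]
          + mono b ![0, 2, 5, 6]) := by
      have hmain : mono b ![0, 1, 2, 3] + ε • mono b ![2, 3, 4, 5] + ε • mono b ![0, 1, 4, 5] =
          annForm (basisFour f 2 3 4 5 + basisFour f 0 1 4 5 + basisFour f 0 1 2 3) := by
        apply Subtype.ext
        have hb0 : b.coord 0 = f 0 := hb 0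
        have hb1 : b.coord 1 = f 1 := hb 1
        have hb2 : b.coord 2 = f 2 := hb 2
        have hb3 : b.coord 3 = f 3 := hb 3
        have hb4 : b.coord 4 = (ε : F) • (f 4 : Dual F V) := hb 4
        have hb5 : b.coord 5 = f 5 := hb 5
        rw [annForm_add, annForm_add]
        simp only [Submodule.coe_add, Submodule.coe_smul_of_tower, coe_mono, annForm_basisFour,
          List.ofFn_succ, List.ofFn_zero, wordProd_cons, wordProd_nil, Matrix.cons_val_zero,
          Matrix.cons_val_succ, hb0, hb1, hb2, hb3, hb4, hb5, mul_one, map_smul,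
          smul_mul_assoc, mul_smul_comm, ← Int.cast_smul_eq_zsmul F, smul_smul, hεε, one_smul]
        abel
      rw [starForm, hmain]
      abel
    rw [hstar, add_sub_cancel_left]
    exact add_mem (add_mem (add_mem (neg_mem (hmult _ _ _)) (hmult _ _ _)) (hmult _ _ _))
      (hmult _ _ _)

/-- Substituting `e⁷ = η - e¹` in `⋆φ₋₁`, the terms without `η` factor as on the right. The factored
form has rank four, which is why a null `η` yields length two. -/
lemma null_words : WordSum.equiv
    [(1, [0, 1, 2, 3]), (-1, [2, 3, 4, 5]), (-1, [0, 1, 4, 5]), (1, [1, 3, 5, 0]),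
      (-1, [1, 2, 4, 0]), (-1, [0, 3, 4, 0]), (-1, [0, 2, 5, 0])]
    (WordSum.mul (n := 7)
      (WordSum.mul [(1, [5, 4]), (1, [0, 1])] [(1, [2]), (1, [5])]) [(1, [3]), (1, [4])])
    = true := by
  decide +kernel

lemma coe_ιMulti_four (p q r s : Dual F V) :
    ((exteriorPower.ιMulti F 4 ![p, q, r, s] : Form F V 4) : ExteriorAlgebra F (Dual F V)) =
      ι F p * (ι F q * (ι F r * ι F s)) := by
  rw [exteriorPower.ιMulti_apply_coe, ιMulti_apply]
  simp [List.ofFn_succ]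

lemma mono_four (b : Basis (Fin 7) F V) (i j k l : Fin 7) :
    mono b ![i, j, k, l] =
      exteriorPower.ιMulti F 4 ![b.coord i, b.coord j, b.coord k, b.coord l] := by
  rw [mono]
  congr 1
  ext1 m
  fin_cases m <;> rfl

/-- Bookkeeping that separates the terms containing `t`; here `t` stands for `η` and `t - a₀` for
`e⁷`. -/
lemma null_identity {A : Type*} [Ring A] (a₀ a₁ a₂ a₃ a₄ a₅ t : A)
    (h : a₀ * (a₁ * (a₂ * a₃)) + (-(a₂ * (a₃ * (a₄ * a₅))) + (-(a₀ * (a₁ * (a₄ * a₅))) +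
      (a₁ * (a₃ * (a₅ * a₀)) + (-(a₁ * (a₂ * (a₄ * a₀))) + (-(a₀ * (a₃ * (a₄ * a₀))) +
        -(a₀ * (a₂ * (a₅ * a₀)))))))) = (a₅ * a₄ + a₀ * a₁) * (a₂ + a₅) * (a₃ + a₄)) :
    a₀ * (a₁ * (a₂ * a₃)) + -(a₂ * (a₃ * (a₄ * a₅))) + -(a₀ * (a₁ * (a₄ * a₅)))
      - a₁ * (a₃ * (a₅ * (t - a₀))) + a₁ * (a₂ * (a₄ * (t - a₀))) + a₀ * (a₃ * (a₄ * (t - a₀)))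
      + a₀ * (a₂ * (a₅ * (t - a₀))) =
    a₅ * (a₄ * ((a₂ + a₅) * (a₃ + a₄))) + a₀ * (a₁ * ((a₂ + a₅) * (a₃ + a₄))) +
      (-(a₁ * (a₃ * (a₅ * t))) + a₁ * (a₂ * (a₄ * t)) + a₀ * (a₃ * (a₄ * t))
        + a₀ * (a₂ * (a₅ * t))) := by
  have h' : a₅ * (a₄ * ((a₂ + a₅) * (a₃ + a₄))) + a₀ * (a₁ * ((a₂ + a₅) * (a₃ + a₄))) =
      (a₅ * a₄ + a₀ * a₁) * (a₂ + a₅) * (a₃ + a₄) := by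
    simp only [mul_assoc, add_mul]
  rw [h', ← h]
  simp only [mul_sub]
  abel

/-- A four-form of rank four is, up to multiples of `η`, the Hodge dual of a `G₂*`-structure. -/
lemma exists_starForm_of_two (hV : finrank F V = 7) (he : η e = 1)
    (f : Basis (Fin 6) F (Submodule.dualAnnihilator (Submodule.span F {e}))) :
    ∃ b : Basis (Fin 7) F V,
      starForm (-1) b - annForm (basisFour f 2 3 4 5 + basisFour f 0 1 4 5) ∈
        multiplesOf η 4 := by
  -- Chosen so that the factors of `null_words` become `f 2 = e⁶`, `f 3 = e⁵`, `f 4 = e³ + e⁶`, `f 5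
  -- = e⁴ + e⁵`. Then `η = e¹ + e⁷`, which is null because `e¹` and `e⁷` have opposite signs.
  set v : Fin 7 → Dual F V := ![f 0, f 1, (f 4 : Dual F V) - f 2, (f 5 : Dual F V) - f 3, f 3, f 2,
    η - f 0] with hv
  have hmem : ∀ i, v i ∈ Submodule.span F (Set.range v) := fun i => Submodule.subset_span ⟨i, rfl⟩
  obtain ⟨b, hb⟩ := exists_basis_coord_eq_of_span hV he f v
    (by simpa [hv] using add_mem (hmem 6) (hmem 0)) (by
    intro i
    fin_cases i
    · exact hmem 0
    · exact hmem 1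
    · exact hmem 5
    · exact hmem 4
    · simpa [hv] using add_mem (hmem 2) (hmem 5)
    · simpa [hv] using add_mem (hmem 3) (hmem 4))
  have hb0 : (f 0 : Dual F V) = b.coord 0 := (hb 0).symm
  have hb1 : (f 1 : Dual F V) = b.coord 1 := (hb 1).symm
  have hb2 : (f 2 : Dual F V) = b.coord 5 := (hb 5).symm
  have hb3 : (f 3 : Dual F V) = b.coord 4 := (hb 4).symm
  have hb4 : (f 4 : Dual F V) = b.coord 2 + b.coord 5 := by
    rw [hb, hb]; simp [hv]
  have hb5 : (f 5 : Dual F V) = b.coord 3 + b.coord 4 := by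
    rw [hb, hb]; simp [hv]
  have hb6 : b.coord 6 = η - b.coord 0 := by
    rw [hb, hb]; simp [hv]
  refine ⟨b, ?_⟩
  have hmult : ∀ i j k : Fin 7, (exteriorPower.ιMulti F 4 ![b.coord i, b.coord j, b.coord k, η] :
      Form F V 4) ∈ multiplesOf η 4 := fun i j k => ιMulti_mem_multiplesOf (i := 3) rfl
  have hstar : starForm (-1) b = annForm (basisFour f 2 3 4 5 + basisFour f 0 1 4 5) +
      (- exteriorPower.ιMulti F 4 ![b.coord 1, b.coord 3, b.coord 5, η]
        + exteriorPower.ιMulti F 4 ![b.coord 1, b.coord 2, b.coord 4, η]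
        + exteriorPower.ιMulti F 4 ![b.coord 0, b.coord 3, b.coord 4, η]
        + exteriorPower.ιMulti F 4 ![b.coord 0, b.coord 2, b.coord 5, η]) := by
    apply Subtype.ext
    have h := WordSum.eval_ι_eq (F := F) (fun i => b.coord i) null_words
    rw [WordSum.eval_mul, WordSum.eval_mul] at h
    simp only [WordSum.eval_cons, WordSum.eval_nil, wordProd_cons, wordProd_nil, one_smul,
      neg_smul, mul_one, add_zero] at h
    rw [annForm_add, starForm]
    simp only [Submodule.coe_add, Submodule.coe_sub, Submodule.coe_neg, mono_four, coe_ιMulti_four,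
      annForm_basisFour, hb0, hb1, hb2, hb3, hb4, hb5, hb6, neg_smul, one_smul, map_add, map_sub]
    exact null_identity _ _ _ _ _ _ _ h
  rw [hstar, add_sub_cancel_left]
  exact add_mem (add_mem (add_mem (neg_mem (hmult _ _ _)) (hmult _ _ _)) (hmult _ _ _))
    (hmult _ _ _)

end Cobasis

/-! ### Cocalibrated structures and codimension-one abelian ideals -/

section Structures

variable {F : Type*} {L : Type*} [Field F] [LieRing L] [LieAlgebra F L]

/-- The cocalibrated structures are those for which the model of `⋆φ` is closed. -/
lemma exists_cocalibrated_iff [CharZero F] {ε : ℤ} (hε : ε = 1 ∨ ε = -1)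
    (P : LinearMap.BilinForm F L → Prop) :
    (∃ (φ : Form F L 3) (vol : Form F L 7) (g : LinearMap.BilinForm F L),
      ((∃ b : Basis (Fin 7) F L, φ = phiForm ε b ∧ vol = volForm b) ∧ IsInducedMetric φ vol g) ∧
        IsCocalibrated φ vol g ∧ P g) ↔
    ∃ b : Basis (Fin 7) F L, IsClosedForm (starForm ε b) ∧
      P (diagMetric ε b) := by
  constructor
  · rintro ⟨_, _, g, ⟨⟨b, rfl, rfl⟩, hg⟩, ⟨χ, hχ, hcl⟩, hP⟩
    -- Metric and Hodge dual are unique, so both may be replaced by their models.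
    obtain rfl := hg.unique (volForm_ne_zero b) (isInducedMetric_diagMetric hε b)
    obtain rfl := hχ.unique hε b (isHodgeDual_starForm hε b)
    exact ⟨b, hcl, hP⟩
  · rintro ⟨b, hcl, hP⟩
    exact ⟨_, _, _, ⟨⟨b, rfl, rfl⟩, isInducedMetric_diagMetric hε b⟩,
      ⟨_, isHodgeDual_starForm hε b, hcl⟩, hP⟩

/-- A complement of an abelian ideal of codimension one acts by a derivation. -/
lemma exists_coordinate_derivation (hL : finrank F L = 7) (U : LieIdeal F L) [IsLieAbelian U]
    (hU : finrank F U = 6) {e : L} (he : e ∉ U) :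
    ∃ (η : Dual F L) (D : L →ₗ[F] L), η e = 1 ∧ LinearMap.ker η = U.toSubmodule ∧
      (∀ x, η (D x) = 0) ∧ ∀ x y, ⁅x, y⁆ = η x • D y - η y • D x := by
  have : FiniteDimensional F L := FiniteDimensional.of_finrank_pos (by omega)
  obtain ⟨f, hf, hle⟩ := Submodule.exists_le_ker_of_notMem (p := U.toSubmodule) (v := e) he
  set η : Dual F L := (f e)⁻¹ • f with hη
  have hηe : η e = 1 := by simp [hη, hf]
  have hleη : U.toSubmodule ≤ LinearMap.ker η := fun x hx => by
    have h0 : f x = 0 := hle hx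
    simp [hη, h0]
  have hker : LinearMap.ker η = U.toSubmodule := by
    refine (Submodule.eq_of_le_of_finrank_le hleη ?_).symm
    have h1 := LinearMap.finrank_range_add_finrank_ker η
    have h2 : LinearMap.range η = ⊤ := LinearMap.range_eq_top.2 fun c => ⟨c • e, by simp [hηe]⟩
    rw [h2, finrank_top, finrank_self, hL] at h1
    have h3 : finrank F U.toSubmodule = 6 := hU
    omega
  have hmem : ∀ x, x - η x • e ∈ U := fun x => by
    have : x - η x • e ∈ LinearMap.ker η := by simp [hηe]
    rwa [hker] at this
  have hbr : ∀ x, ⁅e, x⁆ ∈ U := fun x => by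
    have h1 : ⁅e, x - η x • e⁆ ∈ U := lie_mem_right F L U _ _ (hmem x)
    simpa using h1
  refine ⟨η, LieAlgebra.ad F L e, hηe, hker, fun x => ?_, fun x y => ?_⟩
  · have : ⁅e, x⁆ ∈ LinearMap.ker η := by
      rw [hker]
      exact hbr x
    exact this
  · have h0 : ⁅x - η x • e, y - η y • e⁆ = 0 := by
      have := trivial_lie_zero U U ⟨_, hmem x⟩ ⟨_, hmem y⟩
      exact congrArg Subtype.val this
    simp only [sub_lie, lie_sub, smul_lie, lie_smul, lie_self, smul_zero, sub_zero] at h0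
    rw [← lie_skew x e, smul_neg, sub_neg_eq_add, sub_add, sub_eq_zero] at h0
    exact h0

variable {e : L} {η : Dual F L} {D : L →ₗ[F] L}

lemma isClosedForm_annPart (he : η e = 1) (hη : ∀ x, η (D x) = 0)
    (hD : ∀ x y, ⁅x, y⁆ = η x • D y - η y • D x) {χ : Form F L (3 + 1)} (hχ : IsClosedForm χ) :
    IsClosedForm (annForm (annPart he χ)) := by
  rw [← mem_closedForms] at hχ ⊢
  have h := multiplesOf_le_closedForms hη hD (sub_annForm_mem_multiplesOf he (k := 4) χ)
  have := sub_mem hχ h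
  rwa [sub_sub_cancel] at this

/-- Neither a nonzero scalar nor a multiple of `η` affects closedness, so the normal form needs to
be matched only up to these. -/
lemma isClosedForm_of_sub_mem (hη : ∀ x, η (D x) = 0)
    (hD : ∀ x y, ⁅x, y⁆ = η x • D y - η y • D x) {χ : Form F L (3 + 1)} {c : F} (hc : c ≠ 0)
    {X : ⋀[F]^4 (Submodule.dualAnnihilator (Submodule.span F {e}))}
    (hcl : IsClosedForm (annForm (c • X)))
    (h : χ - annForm X ∈ multiplesOf η 4) : IsClosedForm χ := by
  rw [← mem_closedForms] at hcl ⊢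
  rw [annForm_smul, Submodule.smul_mem_iff _ hc] at hcl
  have := add_mem (multiplesOf_le_closedForms hη hD h) hcl
  rwa [sub_add_cancel] at this

/-- If `η` were null, its metric dual `n` would lie in `ker η` and be orthogonal to all of `ker η`,
hence vanish. -/
lemma coordNorm_ne_zero_of_nondegenerate {ε : ℤ} (hε : ε = 1 ∨ ε = -1) (b : Basis (Fin 7) F L)
    {S : Submodule F L} (hS : LinearMap.ker η = S) (hη : η ≠ 0)
    (h : ((diagMetric ε b).restrict S).Nondegenerate) :
    coordNorm ε (fun k => η (b k)) ≠ 0 := by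
  subst hS
  intro h0
  obtain ⟨n, hn⟩ := (diagMetric_bijective hε b).2 η
  have hcoord : ∀ i, b.coord i n = (metricSign ε i : F) * η (b i) := fun i => by
    rw [← hn, diagMetric_basis_right, ← mul_assoc, metricSign_sq_cast hε, one_mul]
  have hηn : η n = 0 := by
    rw [← hn, diagMetric_apply, ← h0, coordNorm]
    simp only [hcoord, Fin.sum_univ_seven]
    have hs : ∀ i, (metricSign ε i : F) * ((metricSign ε i : F) * η (b i) *
        ((metricSign ε i : F) * η (b i))) = (metricSign ε i : F) * η (b i) ^ 2 := fun i => by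
      linear_combination ((metricSign ε i : F) * η (b i) ^ 2) * metricSign_sq_cast (F := F) hε i
    simp only [hs]
    simp [metricSign]
    ring
  have hz := h.1 ⟨n, hηn⟩ fun u => by
    change diagMetric ε b n u = 0
    rw [hn]
    exact u.2
  have hn0 : n = 0 := congrArg Subtype.val hz
  apply hη
  rw [← hn, hn0, map_zero]

/-- The first six vectors of the orthonormal basis lie in `ker η`, so pairing with them recovers six
coordinates; the seventh is `η` itself. -/
lemma nondegenerate_restrict {ε : ℤ} (hε : ε = 1 ∨ ε = -1) (b : Basis (Fin 7) F L)
    {S : Submodule F L} (hS : LinearMap.ker η = S) (h6 : b.coord 6 = η)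
    (hb : ∀ i : Fin 6, b i.castSucc ∈ LinearMap.ker η) :
    ((diagMetric ε b).restrict S).Nondegenerate := by
  subst hS
  have hleft : ∀ u : LinearMap.ker η, (∀ w : LinearMap.ker η, diagMetric ε b u w = 0) → u = 0 := by
    intro u hu
    apply Subtype.ext
    refine b.ext_elem fun i => ?_
    rw [ZeroMemClass.coe_zero, map_zero, Finsupp.zero_apply, ← Basis.coord_apply]
    refine Fin.lastCases ?_ (fun i => ?_) i
    · change b.coord 6 u = 0
      rw [h6]
      exact u.2
    · have h := hu ⟨_, hb i⟩
      rw [diagMetric_basis_right] at h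
      refine (mul_eq_zero.1 h).resolve_left fun h0 => ?_
      have := metricSign_sq_cast (F := F) hε i.castSucc
      simp [h0] at this
  have hsymm : ∀ v w, diagMetric ε b v w = diagMetric ε b w v := fun v w => by
    simp only [diagMetric_apply, mul_comm (b.coord _ v)]
  exact ⟨hleft, fun u hu => hleft u fun w => (hsymm _ _).trans (hu w)⟩

end Structures

/-! ### From closed four-forms to models and back -/

section Main

variable {F : Type*} {L : Type*} [Field F] [CharZero F] [LieRing L] [LieAlgebra F L]
  {e : L} {η : Dual F L} {D : L →ₗ[F] L}

lemma exists_closed_two_le_kLength (hL : finrank F L = 7) (he : η e = 1) (hη : ∀ x, η (D x) = 0)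
    (hD : ∀ x y, ⁅x, y⁆ = η x • D y - η y • D x) {ε : ℤ} (hε : ε = 1 ∨ ε = -1)
    {b : Basis (Fin 7) F L} (hb : IsClosedForm (starForm ε b)) :
    ∃ Ω : ⋀[F]^4 (Submodule.dualAnnihilator (Submodule.span F {e})),
      IsClosedForm (annForm Ω) ∧ 2 ≤ kLength Ω :=
  ⟨_, isClosedForm_annPart he hη hD hb, two_le_kLength_star hL he hε b⟩

omit [CharZero F] in
lemma exists_closed_kLength_eq_three (hL : finrank F L = 7) (he : η e = 1)
    (hη : ∀ x, η (D x) = 0) (hD : ∀ x y, ⁅x, y⁆ = η x • D y - η y • D x) {ε : ℤ}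
    (hε : ε = 1 ∨ ε = -1) {b : Basis (Fin 7) F L}
    (hb : IsClosedForm (starForm ε b))
    (hN : coordNorm ε (fun k => η (b k)) ≠ 0) :
    ∃ Ω : ⋀[F]^4 (Submodule.dualAnnihilator (Submodule.span F {e})),
      IsClosedForm (annForm Ω) ∧ kLength Ω = 3 :=
  ⟨_, isClosedForm_annPart he hη hD hb, kLength_star_eq_three hL he hε b hN⟩

omit [CharZero F] in
lemma exists_starForm_of_kLength_eq_three (hL : finrank F L = 7) (he : η e = 1)
    (hη : ∀ x, η (D x) = 0) (hD : ∀ x y, ⁅x, y⁆ = η x • D y - η y • D x) {ε : ℤ}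
    (hε : ε = 1 ∨ ε = -1) {S : Submodule F L} (hS : LinearMap.ker η = S)
    (h : ∃ Ω : ⋀[F]^4 (Submodule.dualAnnihilator (Submodule.span F {e})),
      IsClosedForm (annForm Ω) ∧ kLength Ω = 3) :
    ∃ b : Basis (Fin 7) F L, IsClosedForm (starForm ε b) ∧
      ((diagMetric ε b).restrict S).Nondegenerate := by
  obtain ⟨Ω, hcl, h3⟩ := h
  obtain ⟨f, c, hc, rfl⟩ :=
    (kLength_normalForm (finrank_dualAnnihilator_eq_six hL he) Ω).2.2 h3.ge
  obtain ⟨b, h6, hb, hmem⟩ := exists_starForm_of_three hL he hε f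
  exact ⟨b, isClosedForm_of_sub_mem hη hD hc hcl hmem, nondegenerate_restrict hε b hS h6 hb⟩

-- The two normal forms use different models: length two needs a null `η`, length three a non-null
-- one. The sign `-1` allows both.
omit [CharZero F] in
lemma exists_starForm_of_two_le_kLength (hL : finrank F L = 7) (he : η e = 1)
    (hη : ∀ x, η (D x) = 0) (hD : ∀ x y, ⁅x, y⁆ = η x • D y - η y • D x)
    (h : ∃ Ω : ⋀[F]^4 (Submodule.dualAnnihilator (Submodule.span F {e})),
      IsClosedForm (annForm Ω) ∧ 2 ≤ kLength Ω) :
    ∃ b : Basis (Fin 7) F L, IsClosedForm (starForm (-1) b) := by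
  obtain ⟨Ω, hcl, h2⟩ := h
  obtain ⟨f, c, hc, rfl | rfl⟩ :=
    (kLength_normalForm (finrank_dualAnnihilator_eq_six hL he) Ω).2.1 h2
  · obtain ⟨b, hmem⟩ := exists_starForm_of_two hL he f
    exact ⟨b, isClosedForm_of_sub_mem hη hD hc hcl hmem⟩
  · obtain ⟨b, h6, hb, hmem⟩ := exists_starForm_of_three hL he (Or.inr rfl) f
    exact ⟨b, isClosedForm_of_sub_mem hη hD hc hcl hmem⟩

end Main

/-! ### Equivalence of the two signs over the complex numbers -/

section Signature

variable {V : Type*} [AddCommGroup V] [Module ℂ V]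

/-- Over the complex numbers, the forms `φ₁` and `φ₋₁` are equivalent. -/
lemma exists_phiForm_one_eq (b : Basis (Fin 7) ℂ V) :
    ∃ b' : Basis (Fin 7) ℂ V, phiForm 1 b' = phiForm (-1) b ∧ volForm b' = volForm b := by
  have := Module.Finite.of_basis b
  -- Two factors `I` give the sign of `e^{127}` and `e^{347}`. In the last four terms of `φ` these
  -- two factors meet one factor `-1`, and the total product is `1`, so the volume form is
  -- unchanged.
  let t : Fin 7 → ℂ := ![Complex.I, Complex.I, Complex.I, Complex.I, -1, -1, 1]
  have ht : ∀ i, IsUnit (t i) := by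
    intro i
    rw [isUnit_iff_ne_zero]
    fin_cases i <;> simp [t]
  obtain ⟨b', hb'⟩ := exists_basis_coord_eq (b.dualBasis.isUnitSMul ht)
  have hmono : ∀ {k : ℕ} (i : Fin k → Fin 7), mono b' i = (∏ j, t (i j)) • mono b i := by
    intro k i
    rw [mono, mono, ← AlternatingMap.map_smul_univ]
    congr 1
    funext j
    rw [hb', Basis.isUnitSMul_apply, Basis.coe_dualBasis]
  refine ⟨b', ?_, ?_⟩
  · simp only [phiForm, hmono, Fin.prod_univ_three]
    simp [t]
    congr 1
  · simp only [volForm, hmono, Fin.prod_univ_seven]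
    simp [t]

end Signature

/-! ### Equivalences for general sign and field -/

section Equivalences

variable {F : Type*} {L : Type*} [Field F] [CharZero F] [LieRing L] [LieAlgebra F L]

/-- `φ` is equal to `φ_ε` in a basis, with induced volume form `vol` and metric `g`. -/
def IsModelStructure (ε : ℤ) (φ : Form F L 3) (vol : Form F L 7)
    (g : LinearMap.BilinForm F L) : Prop :=
  (∃ b : Basis (Fin 7) F L, φ = phiForm ε b ∧ vol = volForm b) ∧ IsInducedMetric φ vol g

lemma exists_nondegenerate_iff_kLength_eq_three {ε : ℤ} (hε : ε = 1 ∨ ε = -1)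
    (hL : finrank F L = 7) (U : LieIdeal F L) [IsLieAbelian U] (hU : finrank F U = 6) {e : L}
    (he : e ∉ U) :
    (∃ (φ : Form F L 3) (vol : Form F L 7) (g : LinearMap.BilinForm F L),
      IsModelStructure ε φ vol g ∧ IsCocalibrated φ vol g ∧
        (g.restrict U.toSubmodule).Nondegenerate) ↔
    ∃ Ω : ⋀[F]^4 (Submodule.dualAnnihilator (Submodule.span F {e})),
      IsClosedForm (annForm Ω) ∧ kLength Ω = 3 := by
  obtain ⟨η, D, hηe, hker, hη, hD⟩ := exists_coordinate_derivation hL U hU he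
  have hη0 : η ≠ 0 := by
    rintro rfl
    simp at hηe
  refine (exists_cocalibrated_iff hε fun g => (g.restrict U.toSubmodule).Nondegenerate).trans
    ⟨?_, exists_starForm_of_kLength_eq_three hL hηe hη hD hε hker⟩
  rintro ⟨b, hb, hP⟩
  exact exists_closed_kLength_eq_three hL hηe hη hD hε hb
    (coordNorm_ne_zero_of_nondegenerate hε b hker hη0 hP)

lemma exists_two_le_kLength_of_exists {ε : ℤ} (hε : ε = 1 ∨ ε = -1)
    (hL : finrank F L = 7) (U : LieIdeal F L) [IsLieAbelian U] (hU : finrank F U = 6) {e : L}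
    (he : e ∉ U) (h : ∃ (φ : Form F L 3) (vol : Form F L 7) (g : LinearMap.BilinForm F L),
      IsModelStructure ε φ vol g ∧ IsCocalibrated φ vol g) :
    ∃ Ω : ⋀[F]^4 (Submodule.dualAnnihilator (Submodule.span F {e})),
      IsClosedForm (annForm Ω) ∧ 2 ≤ kLength Ω := by
  obtain ⟨η, D, hηe, hker, hη, hD⟩ := exists_coordinate_derivation hL U hU he
  obtain ⟨φ, vol, g, hS, hc⟩ := h
  obtain ⟨b, hb, -⟩ := (exists_cocalibrated_iff hε fun _ => True).1 ⟨φ, vol, g, hS, hc, trivial⟩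
  exact exists_closed_two_le_kLength hL hηe hη hD hε hb

lemma exists_of_two_le_kLength (hL : finrank F L = 7) (U : LieIdeal F L) [IsLieAbelian U]
    (hU : finrank F U = 6) {e : L} (he : e ∉ U)
    (h : ∃ Ω : ⋀[F]^4 (Submodule.dualAnnihilator (Submodule.span F {e})),
      IsClosedForm (annForm Ω) ∧ 2 ≤ kLength Ω) :
    ∃ (φ : Form F L 3) (vol : Form F L 7) (g : LinearMap.BilinForm F L),
      IsModelStructure (-1) φ vol g ∧ IsCocalibrated φ vol g := by
  obtain ⟨η, D, hηe, hker, hη, hD⟩ := exists_coordinate_derivation hL U hU he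
  obtain ⟨b, hb⟩ := exists_starForm_of_two_le_kLength hL hηe hη hD h
  obtain ⟨φ, vol, g, hS, hc, -⟩ :=
    (exists_cocalibrated_iff (Or.inr rfl) fun _ => True).2 ⟨b, hb, trivial⟩
  exact ⟨φ, vol, g, hS, hc⟩

end Equivalences

/-! ### Specialization to the real and complex structures -/

lemma isG2Structure_iff {V : Type*} [AddCommGroup V] [Module ℝ V] {φ : Form ℝ V 3}
    {vol : Form ℝ V 7} {g : LinearMap.BilinForm ℝ V} : IsG2Structure φ vol g ↔
    (∃ b : Basis (Fin 7) ℝ V, φ = phiForm 1 b ∧ vol = volForm b) ∧ IsInducedMetric φ vol g := by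
  simp only [← g2Form_eq_phiForm]
  exact ⟨fun h => ⟨h.1, h.2⟩, fun h => ⟨h.1, h.2⟩⟩

lemma isG2StarStructure_iff {V : Type*} [AddCommGroup V] [Module ℝ V] {φ : Form ℝ V 3}
    {vol : Form ℝ V 7} {g : LinearMap.BilinForm ℝ V} : IsG2StarStructure φ vol g ↔
    (∃ b : Basis (Fin 7) ℝ V, φ = phiForm (-1) b ∧ vol = volForm b) ∧
      IsInducedMetric φ vol g := by
  simp only [← g2StarForm_eq_phiForm]
  exact ⟨fun h => ⟨h.1, h.2⟩, fun h => ⟨h.1, h.2⟩⟩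

lemma isG2CStructure_iff {V : Type*} [AddCommGroup V] [Module ℂ V] {φ : Form ℂ V 3}
    {vol : Form ℂ V 7} {g : LinearMap.BilinForm ℂ V} : IsG2CStructure φ vol g ↔
    (∃ b : Basis (Fin 7) ℂ V, φ = phiForm 1 b ∧ vol = volForm b) ∧ IsInducedMetric φ vol g := by
  simp only [← g2Form_eq_phiForm]
  exact ⟨fun h => ⟨h.1, h.2⟩, fun h => ⟨h.1, h.2⟩⟩

/-- Over the reals, every hyperplane is non-degenerate for a definite metric. -/
lemma coordNorm_one_ne_zero {V : Type*} [AddCommGroup V] [Module ℝ V] (b : Basis (Fin 7) ℝ V)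
    {η : Dual ℝ V} (hη : η ≠ 0) : coordNorm 1 (fun k => η (b k)) ≠ 0 := by
  intro h
  apply hη
  refine b.ext fun m => ?_
  have hsum : ∑ k, η (b k) ^ 2 = 0 := by
    rw [← h, coordNorm, Fin.sum_univ_seven]
    push_cast
    ring
  have hz := (Finset.sum_eq_zero_iff_of_nonneg fun k _ => sq_nonneg (η (b k))).1 hsum m
    (Finset.mem_univ m)
  simpa using hz

/-- For `ε = 1` over `ℝ` every nonzero covector is non-null, so non-degeneracy of the ideal need not
be assumed. -/
lemma exists_definite_iff_kLength_eq_three {L : Type*} [LieRing L] [LieAlgebra ℝ L]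
    (hL : finrank ℝ L = 7) (U : LieIdeal ℝ L) [IsLieAbelian U] (hU : finrank ℝ U = 6) {e : L}
    (he : e ∉ U) :
    (∃ (φ : Form ℝ L 3) (vol : Form ℝ L 7) (g : LinearMap.BilinForm ℝ L),
      IsModelStructure 1 φ vol g ∧ IsCocalibrated φ vol g) ↔
    ∃ Ω : ⋀[ℝ]^4 (Submodule.dualAnnihilator (Submodule.span ℝ {e})),
      IsClosedForm (annForm Ω) ∧ kLength Ω = 3 := by
  constructor
  · rintro ⟨φ, vol, g, hS, hc⟩
    obtain ⟨η, D, hηe, hker, hη, hD⟩ := exists_coordinate_derivation hL U hU he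
    obtain ⟨b, hb, -⟩ := (exists_cocalibrated_iff (Or.inl rfl) fun _ => True).1
      ⟨φ, vol, g, hS, hc, trivial⟩
    refine exists_closed_kLength_eq_three hL hηe hη hD (Or.inl rfl) hb
      (coordNorm_one_ne_zero b ?_)
    rintro rfl
    simp at hηe
  · intro h
    obtain ⟨φ, vol, g, hS, hc, -⟩ :=
      (exists_nondegenerate_iff_kLength_eq_three (Or.inl rfl) hL U hU he).2 h
    exact ⟨φ, vol, g, hS, hc⟩

end CocalibratedG2

open CocalibratedG2 in
theorem mainTheorem7 :
    -- the real case
    (∀ (L : Type*) [LieRing L] [LieAlgebra ℝ L] (_ : Module.finrank ℝ L = 7)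
      (U : LieIdeal ℝ L) [IsLieAbelian U] (_ : Module.finrank ℝ U = 6) (e : L) (_ : e ∉ U),
      -- cocalibrated G₂-structures
      ((∃ (φ : Form ℝ L 3) (vol : Form ℝ L 7) (g : LinearMap.BilinForm ℝ L),
          IsG2Structure φ vol g ∧ IsCocalibrated φ vol g) ↔
        ∃ Ω : ⋀[ℝ]^4 (Submodule.dualAnnihilator (Submodule.span ℝ {e})),
          IsClosedForm (annForm Ω) ∧ kLength Ω = 3) ∧
      -- cocalibrated G₂*-structures for which the ideal is non-degenerate
      ((∃ Ω : ⋀[ℝ]^4 (Submodule.dualAnnihilator (Submodule.span ℝ {e})),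
          IsClosedForm (annForm Ω) ∧ kLength Ω = 3) ↔
        ∃ (φ : Form ℝ L 3) (vol : Form ℝ L 7) (g : LinearMap.BilinForm ℝ L),
          IsG2StarStructure φ vol g ∧ IsCocalibrated φ vol g ∧
            (g.restrict U.toSubmodule).Nondegenerate) ∧
      -- cocalibrated G₂*-structures
      ((∃ (φ : Form ℝ L 3) (vol : Form ℝ L 7) (g : LinearMap.BilinForm ℝ L),
          IsG2StarStructure φ vol g ∧ IsCocalibrated φ vol g) ↔
        ∃ Ω : ⋀[ℝ]^4 (Submodule.dualAnnihilator (Submodule.span ℝ {e})),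
          IsClosedForm (annForm Ω) ∧ 2 ≤ kLength Ω)) ∧
    -- the complex case
    (∀ (L : Type*) [LieRing L] [LieAlgebra ℂ L] (_ : Module.finrank ℂ L = 7)
      (U : LieIdeal ℂ L) [IsLieAbelian U] (_ : Module.finrank ℂ U = 6) (e : L) (_ : e ∉ U),
      -- cocalibrated (G₂)_ℂ-structures
      ((∃ (φ : Form ℂ L 3) (vol : Form ℂ L 7) (g : LinearMap.BilinForm ℂ L),
          IsG2CStructure φ vol g ∧ IsCocalibrated φ vol g) ↔
        ∃ Ω : ⋀[ℂ]^4 (Submodule.dualAnnihilator (Submodule.span ℂ {e})),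
          IsClosedForm (annForm Ω) ∧ 2 ≤ kLength Ω) ∧
      -- cocalibrated (G₂)_ℂ-structures for which the ideal is non-degenerate
      ((∃ (φ : Form ℂ L 3) (vol : Form ℂ L 7) (g : LinearMap.BilinForm ℂ L),
          IsG2CStructure φ vol g ∧ IsCocalibrated φ vol g ∧
            (g.restrict U.toSubmodule).Nondegenerate) ↔
        ∃ Ω : ⋀[ℂ]^4 (Submodule.dualAnnihilator (Submodule.span ℂ {e})),
          IsClosedForm (annForm Ω) ∧ kLength Ω = 3)) := by
  constructor
  · intro L _ _ hL U _ hU e he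
    simp only [isG2Structure_iff, isG2StarStructure_iff]
    exact ⟨exists_definite_iff_kLength_eq_three hL U hU he,
      (exists_nondegenerate_iff_kLength_eq_three (Or.inr rfl) hL U hU he).symm,
      exists_two_le_kLength_of_exists (Or.inr rfl) hL U hU he,
      exists_of_two_le_kLength hL U hU he⟩
  · intro L _ _ hL U _ hU e he
    simp only [isG2CStructure_iff]
    refine ⟨⟨exists_two_le_kLength_of_exists (Or.inl rfl) hL U hU he, fun h => ?_⟩,
      exists_nondegenerate_iff_kLength_eq_three (Or.inl rfl) hL U hU he⟩
    -- The construction yields a structure of sign `-1`. Changing only the adapted basis turns it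
    -- into one of sign `1` with the same `φ`, `vol` and `g`.
    obtain ⟨φ, vol, g, ⟨⟨b, hφ, hvol⟩, hg⟩, hc⟩ := exists_of_two_le_kLength hL U hU he h
    obtain ⟨b', hφ', hvol'⟩ := exists_phiForm_one_eq b
    exact ⟨φ, vol, g, ⟨⟨b', hφ.trans hφ'.symm, hvol.trans hvol'.symm⟩, hg⟩, hc⟩
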